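/- Define $$\gamma = 1-\max_{z\in[0,1/4]}\frac{z^3(5-38z+92z^2-80z^3)}{(1-3z+3z^2)^2}=0.986882\ldots$$ There is a function $\varepsilon:\mathbb{N}\to\mathbb{R}$ with $\varepsilon(n)\to 0$ as $n\to\infty$ such that every finite simple graph $G$ with no independent set of size three (that is, $\alpha(G)\le 2$) has a simple minor $H$ with $|V(H)|=\lceil |V(G)|/2\rceil$ and $$|E(H)|\ \ge\ \bigl(\gamma-\varepsilon(|V(G)|)\bigr)\binom{|V(H)|}{2}.$$ Here a simple graph $H$ is a minor of $G$ if there are pairwise disjoint vertex sets $B_w\subseteq V(G)$, $w\in V(H)$, each inducing a non-empty connected subgraph of $G$, such that $G$ has an edge between $B_u$ and $B_w$ whenever $uw\in E(H)$. -/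

import Mathlib

open Filter Topology

/-- `H` is a minor of `G`: there are pairwise disjoint vertex sets of `G`, one for each vertex of
`H`, each inducing a connected (in particular nonempty) subgraph of `G`, such that the sets of any
two adjacent vertices of `H` are joined by an edge of `G`. -/
def SimpleGraph.IsMinor {W V : Type*} (H : SimpleGraph W) (G : SimpleGraph V) : Prop :=
  ∃ B : W → Set V,
    (∀ w, (G.induce (B w)).Connected) ∧
    (∀ u w, u ≠ w → Disjoint (B u) (B w)) ∧
    (∀ u w, H.Adj u w → ∃ x ∈ B u, ∃ y ∈ B w, G.Adj x y)

/-- The function of `z` whose maximum over `[0, 1/4]` is `1 - γ`. -/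
noncomputable def missingDensity (z : ℝ) : ℝ :=
  z ^ 3 * (5 - 38 * z + 92 * z ^ 2 - 80 * z ^ 3) / (1 - 3 * z + 3 * z ^ 2) ^ 2

/-!
Let `T = Gᶜ`, a triangle-free graph on `n` vertices, and let `C` be a maximum clique of `G`, of size
`q`. The branch sets are vertices of `C`, edges of `G` outside `C`, and gulls, that is, induced
two-edge paths of `G`. The ends of a gull are adjacent in `T`, so they have no common neighbor in
`T`, and a gull therefore touches every other branch set.

A maximum gull packing leaves over a biclique of `T`. If this leftover is large, then exchanging
vertices between it and the gulls produces either a large independent set of `T` or two sets that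
are completely joined in `T` and miss only one vertex of each gull.

If `4 * q ≥ n`, the vertices of `C` and about `n / 2 - q` gulls suffice, unless there are two sets
of total size at least `n / 2` that are completely joined in `T`; two such sets of largest total
size satisfy Hall's condition and yield a complete minor.

If `4 * q < n`, one takes `C`, about `(n - 4 * q) / 2` disjoint edges outside `C`, and `q` gulls.
The edges are those found among random disjoint pairs. Since neighborhoods in `T` are independent,
its degrees are at most `q`, and counting walks in `T` bounds the expected number of pairs of
branch sets that do not touch by `missingDensity (q / n) * n ^ 2 / 8 + O(n)`. By a second moment
bound, the number of edges found is smaller than expected by at most `O(n ^ (3 / 4))`, which gives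
the error term `ε n = O(n ^ (-1 / 4))`.
-/

section

open Finset
open scoped BigOperators Classical SimpleGraph

section GullPacking

variable {V : Type*} {T : SimpleGraph V} {L Q S S' : Finset V} {F F' : Finset (Finset V)}

lemma not_adj_of_isIndepSet {s : Set V} (hs : T.IsIndepSet s) {u v : V} (hu : u ∈ s)
    (hv : v ∈ s) : ¬ T.Adj u v :=
  fun h => hs hu hv h.ne h

lemma not_adj_of_triangleFree (hT : T.CliqueFree 3) {a b c : V} (hab : T.Adj a b)
    (hbc : T.Adj b c) : ¬ T.Adj a c :=
  not_adj_of_isIndepSet (T.isIndepSet_neighborSet_of_triangleFree hT b) hab.symm hbc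

/-- A gull of `T`: three vertices spanning exactly one edge. In a graph `G` these are the induced
two-edge paths of `G` when `T = Gᶜ`. -/
def IsGull (T : SimpleGraph V) (S : Finset V) : Prop :=
  ∃ a b c, T.Adj a b ∧ ¬ T.Adj a c ∧ ¬ T.Adj b c ∧ S = {a, b, c}

lemma isGull_triple {a b c : V} (hab : T.Adj a b) (hac : ¬ T.Adj a c) (hbc : ¬ T.Adj b c) :
    IsGull T {a, b, c} :=
  ⟨a, b, c, hab, hac, hbc, rfl⟩

lemma IsGull.card_eq_three (h : IsGull T S) : #S = 3 := by
  obtain ⟨a, b, c, hab, hac, hbc, rfl⟩ := h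
  have hne_ac : a ≠ c := fun h => hbc (h ▸ hab.symm)
  have hne_bc : b ≠ c := fun h => hac (h ▸ hab)
  exact Finset.card_eq_three.2 ⟨a, b, c, hab.ne, hne_ac, hne_bc, rfl⟩

lemma IsGull.nonempty (h : IsGull T S) : S.Nonempty :=
  card_pos.1 (by rw [h.card_eq_three]; norm_num)

/-- A gull packing in `L`: a family of pairwise disjoint gulls inside `L`. -/
structure IsGullPacking (T : SimpleGraph V) (L : Finset V) (F : Finset (Finset V)) : Prop where
  isGull : ∀ S ∈ F, IsGull T S
  subset : ∀ S ∈ F, S ⊆ L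
  pairwiseDisjoint : (F : Set (Finset V)).PairwiseDisjoint id

/-- The vertices of `L` that lie in no member of the family `F`. -/
noncomputable def leftover (L : Finset V) (F : Finset (Finset V)) : Finset V := L \ F.biUnion id

/-- A gull packing in `L` with as many gulls as possible. -/
structure IsMaxGullPacking (T : SimpleGraph V) (L : Finset V) (F : Finset (Finset V)) : Prop
    extends IsGullPacking T L F where
  card_le : ∀ F', IsGullPacking T L F' → #F' ≤ #F

lemma mem_leftover {v : V} : v ∈ leftover L F ↔ v ∈ L ∧ ∀ S ∈ F, v ∉ S := by
  simp [leftover]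

lemma leftover_subset : leftover L F ⊆ L := sdiff_subset

lemma leftover_insert : leftover L (insert S F) = leftover L F \ S := by
  ext v
  simp only [mem_leftover, Finset.mem_sdiff, forall_mem_insert]
  tauto

lemma leftover_union : leftover L (F ∪ F') = leftover (leftover L F) F' := by
  rw [leftover, leftover, leftover, union_biUnion, sdiff_sdiff_left, sup_eq_union]

lemma card_leftover_add_mul_card (hF : (F : Set (Finset V)).PairwiseDisjoint id)
    (hsub : ∀ S ∈ F, S ⊆ L) {r : ℕ} (hr : ∀ S ∈ F, #S = r) :
    #(leftover L F) + r * #F = #L := by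
  have hcard : #(F.biUnion id) = r * #F := by
    rw [card_biUnion hF, mul_comm]
    exact sum_const_nat hr
  have hle : F.biUnion id ⊆ L := biUnion_subset.2 hsub
  rw [leftover, ← hcard, card_sdiff_add_card_eq_card hle]

lemma disjoint_of_subset_leftover (hS : S ⊆ leftover L F) (hQ : Q ∈ F) : Disjoint S Q :=
  disjoint_left.2 fun _ hx => (mem_leftover.1 (hS hx)).2 Q hQ

lemma notMem_of_subset_leftover (hne : S.Nonempty) (hS : S ⊆ leftover L F) : S ∉ F :=
  fun h => hne.ne_empty (disjoint_self_iff_empty S |>.1 (disjoint_of_subset_leftover hS h))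

namespace IsGullPacking

protected lemma empty : IsGullPacking T L ∅ := ⟨by simp, by simp, by simp⟩

lemma mono (hF : IsGullPacking T L F) (h : F' ⊆ F) : IsGullPacking T L F' :=
  ⟨fun S hS => hF.isGull S (h hS), fun S hS => hF.subset S (h hS),
    hF.pairwiseDisjoint.subset (coe_subset.2 h)⟩

protected lemma insert (hF : IsGullPacking T L F) (hS : IsGull T S) (hsub : S ⊆ leftover L F) :
    IsGullPacking T L (insert S F) where
  isGull := by simpa only [forall_mem_insert] using ⟨hS, hF.isGull⟩
  subset := by simpa only [forall_mem_insert] using ⟨hsub.trans leftover_subset, hF.subset⟩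
  pairwiseDisjoint := by
    rw [coe_insert]
    exact hF.pairwiseDisjoint.insert fun Q hQ _ => disjoint_of_subset_leftover hsub hQ

lemma leftover_erase (hF : IsGullPacking T L F) (hQ : Q ∈ F) :
    leftover L (F.erase Q) = Q ∪ leftover L F := by
  have hdisj : leftover L (F.erase Q) \ Q = leftover L F := by
    rw [← leftover_insert, insert_erase hQ]
  rw [← hdisj, union_sdiff_self_eq_union, eq_comm, union_eq_right]
  intro x hx
  refine mem_leftover.2 ⟨hF.subset Q hQ hx, fun S hS hxS => ?_⟩
  exact disjoint_left.1 (hF.pairwiseDisjoint (mem_of_mem_erase hS) hQ (ne_of_mem_erase hS)) hxS hx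

lemma exchange (hF : IsGullPacking T L F) (hQ : Q ∈ F) (hS : IsGull T S)
    (hsub : S ⊆ Q ∪ leftover L F) : IsGullPacking T L (insert S (F.erase Q)) :=
  (hF.mono (erase_subset Q F)).insert hS (by rwa [hF.leftover_erase hQ])

lemma leftover_exchange (hF : IsGullPacking T L F) (hQ : Q ∈ F) :
    leftover L (insert S (F.erase Q)) = (Q ∪ leftover L F) \ S := by
  rw [leftover_insert, hF.leftover_erase hQ]

lemma card_leftover_add (hF : IsGullPacking T L F) : #(leftover L F) + 3 * #F = #L :=
  card_leftover_add_mul_card hF.pairwiseDisjoint hF.subset fun S hS =>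
    (hF.isGull S hS).card_eq_three

end IsGullPacking

lemma exists_isMaxGullPacking (T : SimpleGraph V) (L : Finset V) :
    ∃ F, IsMaxGullPacking T L F := by
  have hne : {F ∈ L.powerset.powerset | IsGullPacking T L F}.Nonempty :=
    ⟨∅, by simpa using IsGullPacking.empty⟩
  obtain ⟨F, hF, hmax⟩ := exists_max_image _ card hne
  refine ⟨F, (mem_filter.1 hF).2, fun F' hF' => hmax F' (mem_filter.2 ⟨?_, hF'⟩)⟩
  exact mem_powerset.2 fun S hS => mem_powerset.2 (hF'.subset S hS)

namespace IsMaxGullPacking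

lemma not_isGull (hF : IsMaxGullPacking T L F) (hsub : S ⊆ leftover L F) : ¬ IsGull T S := by
  intro hS
  have hcard := hF.card_le _ (hF.insert hS hsub)
  rw [card_insert_of_notMem (notMem_of_subset_leftover hS.nonempty hsub)] at hcard
  exact absurd hcard (Nat.not_succ_le_self _)

lemma exchange (hF : IsMaxGullPacking T L F) (hQ : Q ∈ F) (hS : IsGull T S)
    (hsub : S ⊆ Q ∪ leftover L F) : IsMaxGullPacking T L (insert S (F.erase Q)) := by
  refine ⟨hF.toIsGullPacking.exchange hQ hS hsub, fun F' hF' => ?_⟩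
  rw [card_insert_of_notMem (notMem_of_subset_leftover (L := L) hS.nonempty
    (by rwa [hF.leftover_erase hQ])), card_erase_add_one hQ]
  exact hF.card_le F' hF'

lemma not_disjoint_of_isGull (hF : IsMaxGullPacking T L F) (hQ : Q ∈ F) (hS : IsGull T S)
    (hS' : IsGull T S') (hsub : S ⊆ Q ∪ leftover L F) (hsub' : S' ⊆ Q ∪ leftover L F) :
    ¬ Disjoint S S' := by
  intro hd
  refine (hF.exchange hQ hS hsub).not_isGull ?_ hS'
  rw [hF.leftover_exchange hQ]
  exact subset_sdiff.2 ⟨hsub', hd.symm⟩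

end IsMaxGullPacking

/-- `A` and `B` are the sides of an induced complete bipartite subgraph of `T`; a side may be
empty. -/
structure IsBiclique (T : SimpleGraph V) (A B : Finset V) : Prop where
  isIndepSet_left : T.IsIndepSet A
  isIndepSet_right : T.IsIndepSet B
  isCompleteBetween : T.IsCompleteBetween A B

namespace IsBiclique

variable {A B : Finset V}

lemma symm (h : IsBiclique T A B) : IsBiclique T B A :=
  ⟨h.isIndepSet_right, h.isIndepSet_left, h.isCompleteBetween.symm⟩

lemma disjoint (h : IsBiclique T A B) : Disjoint A B :=
  disjoint_coe.1 h.isCompleteBetween.disjoint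

end IsBiclique

lemma exists_isBiclique_of_gullFree (hT : T.CliqueFree 3) {R : Finset V}
    (hR : ∀ S ⊆ R, ¬ IsGull T S) : ∃ A B, IsBiclique T A B ∧ A ∪ B = R := by
  by_cases hE : ∃ a ∈ R, ∃ b ∈ R, T.Adj a b
  · obtain ⟨a, ha, b, hb, hab⟩ := hE
    have hnbr : ∀ v, T.IsIndepSet ({u ∈ R | T.Adj v u} : Finset V) := fun v =>
      (T.isIndepSet_neighborSet_of_triangleFree hT v).mono fun u hu => (mem_filter.1 hu).2
    refine ⟨{v ∈ R | T.Adj b v}, {v ∈ R | T.Adj a v}, ⟨hnbr b, hnbr a, ?_⟩, ?_⟩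
    · intro x hx y hy
      rw [mem_coe, mem_filter] at hx hy
      by_contra hxy
      refine hR {x, b, y} (by simp [insert_subset_iff, hx.1, hy.1, hb])
        (isGull_triple hx.2.symm hxy (not_adj_of_triangleFree hT hab.symm hy.2))
    · rw [← filter_or, filter_eq_self]
      intro x hx
      by_contra! h
      exact hR {a, b, x} (by simp [insert_subset_iff, ha, hb, hx]) (isGull_triple hab h.2 h.1)
  · push Not at hE
    exact ⟨R, ∅, ⟨fun u hu v hv _ => hE u hu v hv, by simp,
      by simp [SimpleGraph.IsCompleteBetween]⟩, by simp⟩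

end GullPacking

section Unbalanced

variable {V : Type*} {T : SimpleGraph V} {L Q A B : Finset V} {F : Finset (Finset V)}

/-- `F` is a maximum gull packing in `L`, and the vertices it leaves over form the biclique with
sides `A` and `B`. -/
structure HasBicliqueLeftover (T : SimpleGraph V) (L : Finset V) (F : Finset (Finset V))
    (A B : Finset V) : Prop extends IsMaxGullPacking T L F, IsBiclique T A B where
  union_eq : A ∪ B = leftover L F

namespace HasBicliqueLeftover

protected lemma symm (h : HasBicliqueLeftover T L F A B) : HasBicliqueLeftover T L F B A :=
  ⟨h.toIsMaxGullPacking, h.toIsBiclique.symm, by rw [union_comm, h.union_eq]⟩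

lemma left_subset (h : HasBicliqueLeftover T L F A B) : A ⊆ leftover L F :=
  h.union_eq ▸ subset_union_left

lemma right_subset (h : HasBicliqueLeftover T L F A B) : B ⊆ leftover L F :=
  h.symm.left_subset

lemma card_add (h : HasBicliqueLeftover T L F A B) : #A + #B + 3 * #F = #L := by
  rw [← card_union_of_disjoint h.disjoint, h.union_eq, h.card_leftover_add]

end HasBicliqueLeftover

lemma exists_hasBicliqueLeftover (hT : T.CliqueFree 3) (L : Finset V) :
    ∃ F A B, HasBicliqueLeftover T L F A B := by
  obtain ⟨F, hF⟩ := exists_isMaxGullPacking T L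
  obtain ⟨A, B, hAB, hunion⟩ := exists_isBiclique_of_gullFree hT fun S hS => hF.not_isGull hS
  exact ⟨F, A, B, hF, hAB, hunion⟩

/-- A maximum gull packing with biclique leftover, chosen so that the smaller side of the biclique
is as large as possible. -/
structure IsBalancedPacking (T : SimpleGraph V) (L : Finset V) (F : Finset (Finset V))
    (A B : Finset V) : Prop extends HasBicliqueLeftover T L F A B where
  min_le : ∀ F' A' B', HasBicliqueLeftover T L F' A' B' → min #A' #B' ≤ min #A #B

lemma IsBalancedPacking.symm (h : IsBalancedPacking T L F A B) : IsBalancedPacking T L F B A :=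
  ⟨h.toHasBicliqueLeftover.symm, by simpa only [min_comm #B #A] using h.min_le⟩

lemma exists_isBalancedPacking (hT : T.CliqueFree 3) (L : Finset V) :
    ∃ F A B, IsBalancedPacking T L F A B ∧ #B ≤ #A := by
  let s : Set ℕ := {b | ∃ F A B, HasBicliqueLeftover T L F A B ∧ min #A #B = b}
  have hne : s.Nonempty := by
    obtain ⟨F, A, B, h⟩ := exists_hasBicliqueLeftover hT L
    exact ⟨_, F, A, B, h, rfl⟩
  have hbdd : BddAbove s := by
    refine ⟨#L, ?_⟩
    rintro _ ⟨F, A, B, h, rfl⟩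
    exact (min_le_left _ _).trans (card_le_card (h.left_subset.trans leftover_subset))
  obtain ⟨F, A, B, h, hmin⟩ := Nat.sSup_mem hne hbdd
  have hbal : IsBalancedPacking T L F A B :=
    ⟨h, fun F' A' B' h' => hmin ▸ le_csSup hbdd ⟨F', A', B', h', rfl⟩⟩
  rcases le_total #B #A with hle | hle
  · exact ⟨F, A, B, hbal, hle⟩
  · exact ⟨F, B, A, hbal.symm, hle⟩

lemma IsMaxGullPacking.exists_swap (hF : IsMaxGullPacking T L F) (hQ : Q ∈ F) {p r : V}
    (hp : p ∈ Q) (hr : r ∈ leftover L F) (hg : IsGull T (insert r (Q.erase p))) :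
    ∃ F', IsMaxGullPacking T L F' ∧ F.erase Q ⊆ F' ∧
      leftover L F' = insert p ((leftover L F).erase r) := by
  refine ⟨_, hF.exchange hQ hg ?_, subset_insert _ _, ?_⟩
  · exact insert_subset (mem_union_right _ hr) ((erase_subset _ _).trans subset_union_left)
  · have hrQ : ∀ x ∈ leftover L F, x ∉ Q := fun x hx => (mem_leftover.1 hx).2 Q hQ
    rw [hF.leftover_exchange hQ]
    grind

section EndOfEdge

variable {a b c : V}

-- Otherwise the two stars would be two disjoint gulls.
lemma IsMaxGullPacking.false_of_disjoint_stars (hF : IsMaxGullPacking T L F)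
    (hA : A ⊆ leftover L F) (hind : T.IsIndepSet A) (hQ : {a, b, c} ∈ F) (hab : a ≠ b)
    {r r' q q' : V} (hr : r ∈ A) (hr' : r' ∈ A) (hq : q ∈ A) (hq' : q' ∈ A)
    (har : T.Adj a r) (har' : ¬ T.Adj a r') (hbq : T.Adj b q) (hbq' : ¬ T.Adj b q')
    (hd : Disjoint ({r, r'} : Finset V) {q, q'}) : False := by
  have hAQ : ∀ x ∈ A, x ∉ ({a, b, c} : Finset V) := fun x hx => (mem_leftover.1 (hA hx)).2 _ hQ
  refine hF.not_disjoint_of_isGull hQ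
    (isGull_triple har har' (not_adj_of_isIndepSet hind hr hr'))
    (isGull_triple hbq hbq' (not_adj_of_isIndepSet hind hq hq')) ?_ ?_ ?_
  · grind
  · grind
  · rw [disjoint_left] at hd ⊢
    grind

lemma IsMaxGullPacking.eq_of_adj (hT : T.CliqueFree 3) (hF : IsMaxGullPacking T L F)
    (hA : A ⊆ leftover L F) (hind : T.IsIndepSet A) (hQ : {a, b, c} ∈ F) (hab : T.Adj a b)
    (hle : #{x ∈ A | T.Adj b x} ≤ #{x ∈ A | T.Adj a x}) {q r : V} (hq : q ∈ A) (hr : r ∈ A)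
    (hbq : T.Adj b q) (hbr : T.Adj b r) : q = r := by
  by_contra hne
  have hcard : 1 < #{x ∈ A | T.Adj b x} :=
    one_lt_card.2 ⟨q, by simp [hq, hbq], r, by simp [hr, hbr], hne⟩
  obtain ⟨s, hs, t, ht, hst⟩ := one_lt_card.1 (hcard.trans_le hle)
  rw [mem_filter] at hs ht
  have hdisj : ∀ x, T.Adj a x → ¬ T.Adj b x := fun x => not_adj_of_triangleFree hT hab.symm
  refine hF.false_of_disjoint_stars hA hind hQ hab.ne hs.1 hr hq ht.1 hs.2
    (fun h => hdisj r h hbr) hbq (hdisj t ht.2) ?_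
  rw [disjoint_left]
  grind

lemma IsMaxGullPacking.adj_of_ne (hT : T.CliqueFree 3) (hF : IsMaxGullPacking T L F)
    (hA : A ⊆ leftover L F) (hind : T.IsIndepSet A) (hcard : 4 ≤ #A) (hQ : {a, b, c} ∈ F)
    (hab : T.Adj a b) (hle : #{x ∈ A | T.Adj b x} ≤ #{x ∈ A | T.Adj a x}) {q r : V}
    (hq : q ∈ A) (hr : r ∈ A) (hbq : T.Adj b q) (hrq : r ≠ q) : T.Adj a r := by
  by_contra har
  have huniq : ∀ x ∈ A, T.Adj b x → x = q := fun x hx hbx =>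
    hF.eq_of_adj hT hA hind hQ hab hle hx hq hbx hbq
  obtain ⟨s, hs⟩ : {x ∈ A | T.Adj a x}.Nonempty :=
    card_pos.1 ((card_pos.2 ⟨q, mem_filter.2 ⟨hq, hbq⟩⟩).trans_le hle)
  rw [mem_filter] at hs
  have hbs : ¬ T.Adj b s := not_adj_of_triangleFree hT hab.symm hs.2
  obtain ⟨t, ht, htn⟩ := exists_mem_notMem_of_card_lt_card
    (card_le_three.trans_lt (Nat.lt_of_succ_le hcard) : #{q, r, s} < #A)
  refine hF.false_of_disjoint_stars hA hind hQ hab.ne hs.1 hr hq ht hs.2 har hbq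
    (fun h => htn (by simp [huniq t ht h])) ?_
  rw [disjoint_left]
  grind

lemma IsMaxGullPacking.not_adj_of_card_le (hT : T.CliqueFree 3) (hF : IsMaxGullPacking T L F)
    (hA : A ⊆ leftover L F) (hind : T.IsIndepSet A) (hcard : 4 ≤ #A) (hQ : {a, b, c} ∈ F)
    (hab : T.Adj a b) (hac : ¬ T.Adj a c) (hbc : ¬ T.Adj b c)
    (hle : #{x ∈ A | T.Adj b x} ≤ #{x ∈ A | T.Adj a x}) : ∀ q ∈ A, ¬ T.Adj b q := by
  intro q hq hbq
  have hAQ : ∀ x ∈ A, x ∉ ({a, b, c} : Finset V) := fun x hx => (mem_leftover.1 (hA hx)).2 _ hQ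
  have huniq : ∀ x ∈ A, x ≠ q → ¬ T.Adj b x := fun x hx hxq hbx =>
    hxq (hF.eq_of_adj hT hA hind hQ hab hle hx hq hbx hbq)
  have hadj : ∀ x ∈ A, x ≠ q → T.Adj a x := fun x hx =>
    hF.adj_of_ne hT hA hind hcard hQ hab hle hq hx hbq
  have hne_ac : a ≠ c := fun h => hbc (h ▸ hab.symm)
  have hne_bc : b ≠ c := fun h => hac (h ▸ hab)
  have hne_ab := hab.ne
  obtain ⟨r, hr, hrq⟩ := exists_mem_ne (by omega : 1 < #A) q
  obtain ⟨s, hs, hsn⟩ := exists_mem_notMem_of_card_lt_card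
    (card_le_two.trans_lt (by omega) : #{q, r} < #A)
  simp only [mem_insert, Finset.mem_singleton, not_or] at hsn
  by_cases hrc : T.Adj c r
  · refine hF.not_disjoint_of_isGull hQ
      (isGull_triple hrc (fun h => hbc h.symm) (fun h => huniq r hr hrq h.symm))
      (isGull_triple (hadj s hs hsn.1) (not_adj_of_triangleFree hT hab hbq)
        (not_adj_of_isIndepSet hind hs hq)) (by grind) (by grind) ?_
    rw [disjoint_left]
    grind
  · refine hF.not_disjoint_of_isGull hQ
      (isGull_triple (hadj r hr hrq) hac (fun h => hrc h.symm))
      (isGull_triple hbq (huniq s hs hsn.1) (not_adj_of_isIndepSet hind hq hs))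
      (by grind) (by grind) ?_
    rw [disjoint_left]
    grind

end EndOfEdge

lemma IsMaxGullPacking.exists_triple_not_adj (hT : T.CliqueFree 3) (hF : IsMaxGullPacking T L F)
    (hA : A ⊆ leftover L F) (hind : T.IsIndepSet A) (hcard : 4 ≤ #A) (hQ : Q ∈ F) :
    ∃ a b c, T.Adj a b ∧ ¬ T.Adj a c ∧ ¬ T.Adj b c ∧ Q = {a, b, c} ∧ ∀ x ∈ A, ¬ T.Adj b x := by
  obtain ⟨a, b, c, hab, hac, hbc, rfl⟩ := hF.isGull Q hQ
  rcases le_total #{x ∈ A | T.Adj b x} #{x ∈ A | T.Adj a x} with h | h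
  · exact ⟨a, b, c, hab, hac, hbc, rfl,
      hF.not_adj_of_card_le hT hA hind hcard hQ hab hac hbc h⟩
  · have hswap : ({a, b, c} : Finset V) = {b, a, c} := insert_comm _ _ _
    exact ⟨b, a, c, hab.symm, hbc, hac, hswap,
      hF.not_adj_of_card_le hT hA hind hcard (hswap ▸ hQ) hab.symm hbc hac h⟩

end Unbalanced

section Swappable

variable {V : Type*} {T : SimpleGraph V} {L Q Q' A B : Finset V}
  {F : Finset (Finset V)} {p p' : V}

/-- The vertex `p` of the gull `Q` has no neighbor in `A`, and at least three vertices of `A` can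
take its place in `Q`. Moving `p` out of `Q` then enlarges the independent set `A`. -/
structure IsSwappable (T : SimpleGraph V) (A Q : Finset V) (p : V) : Prop where
  mem : p ∈ Q
  not_adj : ∀ x ∈ A, ¬ T.Adj p x
  three_le : 3 ≤ #{r ∈ A | IsGull T (insert r (Q.erase p))}

lemma isSwappable_of_forall {P : V → Prop} [DecidablePred P] (hp : p ∈ Q)
    (hA : ∀ x ∈ A, ¬ T.Adj p x) (h3 : 3 ≤ #{r ∈ A | P r})
    (hP : ∀ r ∈ A, P r → IsGull T (insert r (Q.erase p))) :
    IsSwappable T A Q p :=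
  ⟨hp, hA, h3.trans (card_le_card fun r hr =>
    mem_filter.2 ⟨(mem_filter.1 hr).1, hP r (mem_filter.1 hr).1 (mem_filter.1 hr).2⟩)⟩

lemma IsMaxGullPacking.not_adj_of_isSwappable (hF : IsMaxGullPacking T L F)
    (hA : A ⊆ leftover L F) (hQ : Q ∈ F) (hQ' : Q' ∈ F) (hne : Q ≠ Q')
    (hp : IsSwappable T A Q p) (hp' : IsSwappable T A Q' p') : ¬ T.Adj p p' := by
  intro hadj
  have hAQ : ∀ x ∈ A, x ≠ p := fun x hx h => (mem_leftover.1 (hA hx)).2 Q hQ (h ▸ hp.mem)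
  obtain ⟨r, hr⟩ := card_pos.1 (zero_lt_three.trans_le hp.three_le)
  obtain ⟨r', hr', hrr'⟩ := exists_mem_ne (Nat.lt_of_succ_lt hp'.three_le) r
  obtain ⟨s, hs, hsn⟩ := exists_mem_notMem_of_card_lt_card
    (card_le_two.trans_lt (Nat.lt_of_succ_le (hp.three_le.trans (card_filter_le _ _))) :
      #{r, r'} < #A)
  rw [mem_filter] at hr hr'
  simp only [mem_insert, Finset.mem_singleton, not_or] at hsn
  obtain ⟨F₁, hF₁, hsub, hleft₁⟩ := hF.exists_swap hQ hp.mem (hA hr.1) hr.2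
  obtain ⟨F₂, hF₂, -, hleft₂⟩ := hF₁.exists_swap (hsub (mem_erase.2 ⟨hne.symm, hQ'⟩)) hp'.mem
    (hleft₁ ▸ mem_insert_of_mem (mem_erase.2 ⟨hrr', hA hr'.1⟩)) hr'.2
  refine hF₂.not_isGull ?_ (isGull_triple hadj (hp.not_adj s hs) (hp'.not_adj s hs))
  rw [hleft₂, hleft₁]
  have hpr' := hAQ r' hr'.1
  have hsR := hA hs
  grind

lemma IsMaxGullPacking.exists_isIndepSet (hF : IsMaxGullPacking T L F) (hA : A ⊆ leftover L F)
    (hind : T.IsIndepSet A) (hsw : ∀ Q ∈ F, ∃ p, IsSwappable T A Q p) :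
    ∃ I ⊆ L, T.IsIndepSet I ∧ #A + #F = #I := by
  obtain rfl | ⟨Q, hQ⟩ := F.eq_empty_or_nonempty
  · exact ⟨A, hA.trans leftover_subset, hind, by simp⟩
  have : Nonempty V := (hsw Q hQ).nonempty
  choose! p hp using hsw
  have hinj : Set.InjOn p F := by
    intro Q hQ Q' hQ' h
    by_contra hne
    exact disjoint_left.1 (hF.pairwiseDisjoint hQ hQ' hne) (hp Q hQ).mem (h ▸ (hp Q' hQ').mem)
  have hdisj : Disjoint A (F.image p) := by
    rw [disjoint_right, forall_mem_image]
    exact fun Q hQ hx => (mem_leftover.1 (hA hx)).2 Q hQ (hp Q hQ).mem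
  refine ⟨A ∪ F.image p, union_subset (hA.trans leftover_subset) ?_, ?_, ?_⟩
  · exact image_subset_iff.2 fun Q hQ => hF.subset Q hQ (hp Q hQ).mem
  · have : Std.Symm fun v w => ¬ T.Adj v w := ⟨fun _ _ h h' => h h'.symm⟩
    rw [coe_union, coe_image, SimpleGraph.isIndepSet_iff, Set.pairwise_union_of_symm]
    refine ⟨hind, Set.InjOn.pairwise_image hinj |>.2 fun Q hQ Q' hQ' hne => ?_, ?_⟩
    · exact hF.not_adj_of_isSwappable hA hQ hQ' hne (hp Q hQ) (hp Q' hQ')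
    · rintro x hx _ ⟨Q, hQ, rfl⟩ - h
      exact (hp Q hQ).not_adj x hx h.symm
  · rw [card_union_of_disjoint hdisj, card_image_of_injOn hinj]

section NonadjacentPair

variable {a b c : V}

lemma IsBalancedPacking.adj_of_common (h : IsBalancedPacking T L F A B) (hQ : {a, b, c} ∈ F)
    (hab : T.Adj a b) (hbc : ¬ T.Adj b c) (hb : ∀ x ∈ A, ¬ T.Adj b x) {r s t : V} (hr : r ∈ A)
    (hs : s ∈ A) (hrs : s ≠ r) (hcr : T.Adj c r) (has : T.Adj a s) (ht : t ∈ A) (htr : t ≠ r) :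
    T.Adj a t := by
  by_contra hat
  have hAQ : ∀ x ∈ A, x ∉ ({a, b, c} : Finset V) := fun x hx =>
    (mem_leftover.1 (h.left_subset hx)).2 _ hQ
  have hac : a ≠ c := fun he => hbc (he ▸ hab.symm)
  have hsub := h.left_subset
  refine h.not_disjoint_of_isGull hQ
    (isGull_triple hcr (fun he => hbc he.symm) (fun he => hb r hr he.symm))
    (isGull_triple has hat (not_adj_of_isIndepSet h.isIndepSet_left hs ht))
    (by grind) (by grind) ?_
  have hne := hab.ne
  rw [disjoint_left]
  grind

-- Otherwise swapping `a` against a vertex of `A` and adding it to `B` enlarges the smaller side.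
lemma IsBalancedPacking.card_filter_lt_two (hT : T.CliqueFree 3)
    (h : IsBalancedPacking T L F A B) (hBA : #B + 2 ≤ #A) (hQ : {a, b, c} ∈ F)
    (hab : T.Adj a b) (hbc : ¬ T.Adj b c) (hb : ∀ x ∈ A, ¬ T.Adj b x) :
    #{r ∈ A | T.Adj a r ∧ T.Adj c r} < 2 := by
  by_contra! h2
  obtain ⟨r, hr, s, hs, hrs⟩ := one_lt_card.1 (Nat.lt_of_succ_le h2)
  rw [mem_filter] at hr hs
  have hadj : ∀ t ∈ A, t ≠ r → T.Adj a t := fun t =>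
    h.adj_of_common hQ hab hbc hb hr.1 hs.1 hrs.symm hr.2.2 hs.2.1
  have hnot : ∀ t ∈ B, ¬ T.Adj a t := fun t ht =>
    not_adj_of_triangleFree hT hs.2.1 (h.isCompleteBetween hs.1 ht)
  have haR : a ∉ leftover L F := fun ha => (mem_leftover.1 ha).2 _ hQ (by simp)
  have haB : a ∉ B := fun ha => haR (h.right_subset ha)
  have hswap : ({a, b, c} : Finset V).erase a = {b, c} :=
    erase_insert (by simpa using ⟨hab.ne, fun he => hbc (he ▸ hab.symm)⟩)
  have hgull : IsGull T (insert r ({b, c} : Finset V)) :=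
    ⟨c, r, b, hr.2.2, fun he => hbc he.symm, fun he => hb r hr.1 he.symm, by grind⟩
  obtain ⟨F', hF', -, hleft⟩ := h.exists_swap hQ (mem_insert_self a _) (h.left_subset hr.1)
    (by rwa [hswap])
  have hbic : IsBiclique T (A.erase r) (insert a B) := by
    refine ⟨h.isIndepSet_left.mono (by simp), ?_, ?_⟩
    · rw [coe_insert, SimpleGraph.isIndepSet_iff, Set.pairwise_insert]
      exact ⟨h.isIndepSet_right, fun t ht _ => ⟨hnot t ht, fun he => hnot t ht he.symm⟩⟩
    · intro t ht u hu
      rw [mem_coe, mem_erase] at ht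
      rcases mem_insert.1 hu with rfl | hu
      · exact (hadj t ht.2 ht.1).symm
      · exact h.isCompleteBetween ht.2 hu
  have hunion : A.erase r ∪ insert a B = leftover L F' := by
    have hrB := disjoint_left.1 h.disjoint hr.1
    rw [hleft, ← h.union_eq]
    grind
  have hmin := h.min_le F' _ _ ⟨hF', hbic, hunion⟩
  rw [card_insert_of_notMem haB, card_erase_of_mem hr.1] at hmin
  omega

lemma IsMaxGullPacking.adj_of_three_le (hF : IsMaxGullPacking T L F) (hA : A ⊆ leftover L F)
    (hind : T.IsIndepSet A) (hQ : {a, b, c} ∈ F) (hab : T.Adj a b) (hac : ¬ T.Adj a c)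
    (hbc : ¬ T.Adj b c) (hb : ∀ x ∈ A, ¬ T.Adj b x) (h3 : 3 ≤ #{r ∈ A | ¬ T.Adj a r}) {r s : V}
    (hr : r ∈ A) (hcr : T.Adj c r) (hs : s ∈ A) : T.Adj c s := by
  by_contra hcs
  have hAQ : ∀ x ∈ A, x ∉ ({a, b, c} : Finset V) := fun x hx => (mem_leftover.1 (hA hx)).2 _ hQ
  obtain ⟨t, ht, htn⟩ := exists_mem_notMem_of_card_lt_card
    (card_le_two.trans_lt (Nat.lt_of_succ_le h3) : #{r, s} < _)
  rw [mem_filter] at ht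
  refine hF.not_disjoint_of_isGull hQ (isGull_triple hab ht.2 (hb t ht.1))
    (isGull_triple hcr hcs (not_adj_of_isIndepSet hind hr hs)) (by grind) (by grind) ?_
  have hne_ac : a ≠ c := fun he => hbc (he ▸ hab.symm)
  have hne_bc : b ≠ c := fun he => hac (he ▸ hab)
  rw [disjoint_left]
  grind

end NonadjacentPair

lemma IsBalancedPacking.exists_isSwappable (hT : T.CliqueFree 3)
    (h : IsBalancedPacking T L F A B) (hA : 6 ≤ #A) (hBA : #B + 2 ≤ #A) (hQ : Q ∈ F) :
    ∃ p, IsSwappable T A Q p := by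
  obtain ⟨a, b, c, hab, hac, hbc, rfl, hb⟩ :=
    h.exists_triple_not_adj hT h.left_subset h.isIndepSet_left (by omega) hQ
  have hne_ab := hab.ne
  have hne_ac : a ≠ c := fun he => hbc (he ▸ hab.symm)
  have hne_bc : b ≠ c := fun he => hac (he ▸ hab)
  have herase_b : ({a, b, c} : Finset V).erase b = {a, c} := by grind
  have herase_c : ({a, b, c} : Finset V).erase c = {a, b} := by grind
  by_cases h3 : 3 ≤ #{r ∈ A | ¬ T.Adj a r}
  · by_cases hc : ∃ r ∈ A, T.Adj c r
    · obtain ⟨s, hs, hcs⟩ := hc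
      refine ⟨b, isSwappable_of_forall (by simp) hb h3 fun r hr har => ?_⟩
      have hcr : T.Adj c r := h.adj_of_three_le h.left_subset h.isIndepSet_left hQ hab hac hbc hb
        h3 hs hcs hr
      exact ⟨r, c, a, hcr.symm, fun he => har he.symm, fun he => hac he.symm, by grind⟩
    · push Not at hc
      refine ⟨c, isSwappable_of_forall (by simp) hc h3 fun r hr har => ?_⟩
      exact ⟨a, b, r, hab, har, hb r hr, by grind⟩
  · refine ⟨b, isSwappable_of_forall (P := fun r => T.Adj a r ∧ ¬ T.Adj c r) (by simp) hb ?_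
      fun r _ hr => ?_⟩
    · have hcommon := h.card_filter_lt_two hT hBA hQ hab hbc hb
      have hsplit := card_filter_add_card_filter_not (s := A) fun r => T.Adj a r
      have hsplit' := card_filter_add_card_filter_not (s := {r ∈ A | T.Adj a r})
        fun r => T.Adj c r
      rw [filter_filter, filter_filter] at hsplit'
      omega
    · exact ⟨r, a, c, hr.1.symm, fun he => hr.2 he.symm, hac, by grind⟩

end Swappable

section Robust

variable {V : Type*} {T : SimpleGraph V} {L Q P P' R S A B : Finset V} {F : Finset (Finset V)}
  {u v w : V}

/-- The vertex `v` is adjacent to all but at most six vertices of `S`. -/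
def IsNear (T : SimpleGraph V) (S : Finset V) (v : V) : Prop := #{u ∈ S | ¬ T.Adj v u} ≤ 6

lemma IsNear.exists_adj (h : IsNear T S v) {Z : Finset V} (hZ : #Z + 6 < #S) :
    ∃ u ∈ S, u ∉ Z ∧ T.Adj v u := by
  unfold IsNear at h
  obtain ⟨u, hu, hn⟩ := exists_mem_notMem_of_card_lt_card
    ((card_union_le Z {u ∈ S | ¬ T.Adj v u}).trans_lt (by omega) : _ < #S)
  simp only [mem_union, mem_filter, not_or, not_and, not_not] at hn
  exact ⟨u, hu, hn.1, hn.2 hu⟩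

lemma IsNear.not_adj (hT : T.CliqueFree 3) (hS : 12 < #S) (hu : IsNear T S u)
    (hv : IsNear T S v) : ¬ T.Adj u v := by
  intro huv
  obtain ⟨f, hf, hn, huf⟩ := hu.exists_adj (Z := {w ∈ S | ¬ T.Adj v w})
    (by unfold IsNear at hv; omega)
  simp only [mem_filter, not_and, not_not] at hn
  exact not_adj_of_triangleFree hT huv (hn hf) huf

lemma IsBiclique.isNear_right (h : IsBiclique T A B) (hv : v ∈ A) : IsNear T B v := by
  rw [IsNear, filter_false_of_mem fun b hb => not_not.2 (h.isCompleteBetween hv hb)]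
  simp

lemma IsBiclique.isNear_left (h : IsBiclique T A B) (hv : v ∈ B) : IsNear T A v :=
  h.symm.isNear_right hv

/-- Whichever six vertices are forbidden in the reserve `R`, the set `P` together with the rest of
`R` contains a gull. -/
def IsRobust (T : SimpleGraph V) (R P : Finset V) : Prop :=
  ∀ Z : Finset V, #Z ≤ 6 → ∃ S, IsGull T S ∧ S ⊆ P ∪ (R \ Z)

lemma IsRobust.mono (h : IsRobust T R P) (hP : P ⊆ P') : IsRobust T R P' := fun Z hZ =>
  (h Z hZ).imp fun _ hS => ⟨hS.1, hS.2.trans (union_subset_union_left hP)⟩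

lemma IsBiclique.isRobust_of_not_isNear (h : IsBiclique T A B) (hw : w ∈ P)
    (hA : ¬ IsNear T A w) (hB : ¬ IsNear T B w) : IsRobust T (A ∪ B) P := by
  intro Z hZ
  rw [IsNear, not_le] at hA hB
  obtain ⟨r, hr, hrn⟩ := exists_mem_notMem_of_card_lt_card (hZ.trans_lt hA)
  obtain ⟨s, hs, hsn⟩ := exists_mem_notMem_of_card_lt_card (hZ.trans_lt hB)
  rw [mem_filter] at hr hs
  refine ⟨{r, s, w}, isGull_triple (h.isCompleteBetween hr.1 hs.1) (fun e => hr.2 e.symm)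
    (fun e => hs.2 e.symm), ?_⟩
  simp [insert_subset_iff, hr.1, hs.1, hw, hrn, hsn]

lemma IsMaxGullPacking.not_isRobust (hF : IsMaxGullPacking T L F) (hQ : Q ∈ F) (hP : P ⊆ Q)
    (hP' : P' ⊆ Q) (hd : Disjoint P P') (h : IsRobust T (leftover L F) P) :
    ¬ IsRobust T (leftover L F) P' := by
  intro h'
  obtain ⟨S, hS, hsub⟩ := h ∅ (by simp)
  obtain ⟨S', hS', hsub'⟩ := h' S (by simp [hS.card_eq_three])
  have hdisj : Disjoint (leftover L F) Q := disjoint_of_subset_leftover Subset.rfl hQ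
  refine hF.not_disjoint_of_isGull hQ hS hS' (hsub.trans ?_) (hsub'.trans ?_) ?_
  · exact union_subset_union hP sdiff_subset
  · exact union_subset_union hP' sdiff_subset
  · rw [disjoint_left] at hd hdisj ⊢
    grind

/-- The vertex `v` is left over by the packing `F`, or can be exchanged out of its gull in a robust
way. -/
def IsReleasable (T : SimpleGraph V) (L R : Finset V) (F : Finset (Finset V)) (v : V) : Prop :=
  v ∈ leftover L F ∨ ∃ S ∈ F, v ∈ S ∧ IsRobust T R (S.erase v)

lemma IsMaxGullPacking.exists_release (hF : IsMaxGullPacking T L F)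
    (hv : IsReleasable T L R F v) {Z : Finset V} (hZ : #Z ≤ 6)
    (hsub : R \ Z ⊆ leftover L F) :
    ∃ F' S, IsMaxGullPacking T L F' ∧ v ∈ leftover L F' ∧ #S ≤ 3 ∧ S ∩ leftover L F ⊆ R \ Z ∧
      leftover L F \ S ⊆ leftover L F' := by
  rcases hv with hv | ⟨Q, hQ, hvQ, hrob⟩
  · exact ⟨F, ∅, hF, hv, by simp, by simp, sdiff_subset⟩
  obtain ⟨S, hS, hSsub⟩ := hrob Z hZ
  have hdisj : Disjoint (leftover L F) Q := disjoint_of_subset_leftover Subset.rfl hQ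
  rw [disjoint_left] at hdisj
  refine ⟨_, S, hF.exchange hQ hS (hSsub.trans ?_), ?_, hS.card_eq_three.le, ?_, ?_⟩
  · exact union_subset_union (erase_subset _ _) hsub
  · rw [hF.leftover_exchange hQ]
    grind
  · grind
  · rw [hF.leftover_exchange hQ]
    grind

/-- A maximum gull packing whose leftover is a biclique with two large sides. The bound `30` leaves
room for the at most six non-neighbors of a near vertex and for the vertices used by exchanges. -/
structure HasLargeBicliqueLeftover (T : SimpleGraph V) (L : Finset V) (F : Finset (Finset V))
    (A B : Finset V) : Prop extends HasBicliqueLeftover T L F A B where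
  thirty_le_left : 30 ≤ #A
  thirty_le_right : 30 ≤ #B

namespace HasLargeBicliqueLeftover

lemma not_isNear_right (hT : T.CliqueFree 3) (H : HasLargeBicliqueLeftover T L F A B)
    (hA : IsNear T A v) : ¬ IsNear T B v := by
  have hcardA := H.thirty_le_left
  have hcardB := H.thirty_le_right
  intro hB
  obtain ⟨a, ha, -, hva⟩ := hA.exists_adj (Z := ∅) (by rw [card_empty]; omega)
  obtain ⟨b, hb, -, hvb⟩ := hB.exists_adj (Z := ∅) (by rw [card_empty]; omega)
  exact not_adj_of_triangleFree hT hva (H.isCompleteBetween ha hb) hvb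

lemma isNear_or_isNear (H : HasLargeBicliqueLeftover T L F A B) (hv : v ∈ leftover L F) :
    IsNear T A v ∨ IsNear T B v := by
  rw [← H.union_eq, mem_union] at hv
  exact hv.symm.imp H.isNear_left H.isNear_right

lemma not_adj_left (hT : T.CliqueFree 3) (H : HasLargeBicliqueLeftover T L F A B)
    (hu : IsNear T A u) (hv : IsNear T A v) : ¬ T.Adj u v :=
  IsNear.not_adj hT (lt_of_lt_of_le (by norm_num) H.thirty_le_left) hu hv

lemma not_adj_right (hT : T.CliqueFree 3) (H : HasLargeBicliqueLeftover T L F A B)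
    (hu : IsNear T B u) (hv : IsNear T B v) : ¬ T.Adj u v :=
  IsNear.not_adj hT (lt_of_lt_of_le (by norm_num) H.thirty_le_right) hu hv

lemma exists_adj_right (H : HasLargeBicliqueLeftover T L F A B) (hu : IsNear T B u)
    {Z : Finset V} (hZ : #Z ≤ 20) : ∃ f ∈ B, f ∉ Z ∧ T.Adj u f :=
  hu.exists_adj (by have := H.thirty_le_right; omega)

lemma isRobust_of_not_isNear (H : HasLargeBicliqueLeftover T L F A B) (hw : w ∈ P)
    (hA : ¬ IsNear T A w) (hB : ¬ IsNear T B w) : IsRobust T (leftover L F) P :=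
  H.union_eq ▸ H.toIsBiclique.isRobust_of_not_isNear hw hA hB

lemma isRobust_of_not_adj (hT : T.CliqueFree 3) (H : HasLargeBicliqueLeftover T L F A B)
    {x y : V} (hx : x ∈ P) (hy : y ∈ P) (hxB : IsNear T B x) (hyA : IsNear T A y)
    (hxy : ¬ T.Adj x y) : IsRobust T (leftover L F) P := by
  intro Z hZ
  obtain ⟨f, hf, hfZ, hxf⟩ := H.exists_adj_right hxB (hZ.trans (by norm_num))
  refine ⟨{x, f, y}, isGull_triple hxf hxy (H.not_adj_left hT (H.isNear_left hf) hyA), ?_⟩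
  simp [insert_subset_iff, H.right_subset hf, hfZ, hx, hy]

end HasLargeBicliqueLeftover

end Robust

section Repacking

variable {V : Type*} {T : SimpleGraph V} {L Q Q' S U A B : Finset V}
  {D F F' : Finset (Finset V)} {u v f : V}

/-- The gulls of `F` all of whose vertices are near `A` or near `B`. -/
noncomputable def nearGulls (T : SimpleGraph V) (A B : Finset V) (F : Finset (Finset V)) :
    Finset (Finset V) := {Q ∈ F | ∀ w ∈ Q, IsNear T A w ∨ IsNear T B w}

lemma HasLargeBicliqueLeftover.exists_split (hT : T.CliqueFree 3)
    (H : HasLargeBicliqueLeftover T L F A B) (hQ : Q ∈ nearGulls T A B F) :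
    ∃ x y z, Q = {x, y, z} ∧ IsNear T B x ∧ IsNear T A y ∧ ¬ T.Adj x y ∧ z ≠ x ∧ z ≠ y ∧
      (IsNear T A z ∧ T.Adj x z ∨ IsNear T B z) := by
  obtain ⟨hQF, hnear⟩ := mem_filter.1 hQ
  have key : ∀ a b c, T.Adj a b → ¬ T.Adj a c → ¬ T.Adj b c → Q = {a, b, c} → IsNear T A a →
      IsNear T B b → ∃ x y z, Q = {x, y, z} ∧ IsNear T B x ∧ IsNear T A y ∧ ¬ T.Adj x y ∧ z ≠ x ∧
      z ≠ y ∧ (IsNear T A z ∧ T.Adj x z ∨ IsNear T B z) := by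
    rintro a b c hab hac hbc rfl ha hb
    have hne_ac : a ≠ c := fun h => hbc (h ▸ hab.symm)
    have hne_bc : b ≠ c := fun h => hac (h ▸ hab)
    rcases hnear c (by simp) with hc | hc
    · exact ⟨b, c, a, by grind, hb, hc, hbc, hab.ne, hne_ac, .inl ⟨ha, hab.symm⟩⟩
    · exact ⟨c, a, b, by grind, hc, ha, fun h => hac h.symm, hne_bc, hab.ne', .inr hb⟩
  obtain ⟨a, b, c, hab, hac, hbc, rfl⟩ := H.isGull Q hQF
  rcases hnear a (by simp) with ha | ha <;> rcases hnear b (by simp) with hb | hb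
  · exact (H.not_adj_left hT ha hb hab).elim
  · exact key a b c hab hac hbc rfl ha hb
  · exact key b a c hab.symm hbc hac (insert_comm _ _ _) hb ha
  · exact (H.not_adj_right hT ha hb hab).elim

/-- In each gull `Q` of `nearGulls T A B F`, a choice of a non-adjacent pair `x Q`, `y Q` of
vertices near `B` and near `A`, respectively; `spare Q` is the third vertex of `Q`. -/
structure Pairing (T : SimpleGraph V) (A B : Finset V) (F : Finset (Finset V)) where
  x : Finset V → V
  y : Finset V → V
  spare : Finset V → V
  eq_triple : ∀ Q ∈ nearGulls T A B F, Q = {x Q, y Q, spare Q}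
  isNear_x : ∀ Q ∈ nearGulls T A B F, IsNear T B (x Q)
  isNear_y : ∀ Q ∈ nearGulls T A B F, IsNear T A (y Q)
  not_adj : ∀ Q ∈ nearGulls T A B F, ¬ T.Adj (x Q) (y Q)
  spare_ne_x : ∀ Q ∈ nearGulls T A B F, spare Q ≠ x Q
  spare_ne_y : ∀ Q ∈ nearGulls T A B F, spare Q ≠ y Q
  isNear_spare : ∀ Q ∈ nearGulls T A B F,
    IsNear T A (spare Q) ∧ T.Adj (x Q) (spare Q) ∨ IsNear T B (spare Q)

lemma HasLargeBicliqueLeftover.nonempty_pairing (hT : T.CliqueFree 3)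
    (H : HasLargeBicliqueLeftover T L F A B) : Nonempty (Pairing T A B F) := by
  have hA : A.Nonempty := card_pos.1 (by have := H.thirty_le_left; omega)
  have : Nonempty V := hA.to_type
  choose! x y z h using fun Q (hQ : Q ∈ nearGulls T A B F) => H.exists_split hT hQ
  exact ⟨⟨x, y, z, fun Q hQ => (h Q hQ).1, fun Q hQ => (h Q hQ).2.1, fun Q hQ => (h Q hQ).2.2.1,
    fun Q hQ => (h Q hQ).2.2.2.1, fun Q hQ => (h Q hQ).2.2.2.2.1,
    fun Q hQ => (h Q hQ).2.2.2.2.2.1, fun Q hQ => (h Q hQ).2.2.2.2.2.2⟩⟩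

namespace Pairing

variable (P : Pairing T A B F)

lemma x_mem (hQ : Q ∈ nearGulls T A B F) : P.x Q ∈ Q :=
  (Finset.ext_iff.1 (P.eq_triple Q hQ) _).2 (by simp)

lemma y_mem (hQ : Q ∈ nearGulls T A B F) : P.y Q ∈ Q :=
  (Finset.ext_iff.1 (P.eq_triple Q hQ) _).2 (by simp)

lemma spare_mem (hQ : Q ∈ nearGulls T A B F) : P.spare Q ∈ Q :=
  (Finset.ext_iff.1 (P.eq_triple Q hQ) _).2 (by simp)

/-- The vertex `e` may complete the pair chosen in `Q` to a gull of a repacking. -/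
def IsSpare (Q : Finset V) (e : V) : Prop :=
  e ≠ P.x Q ∧ e ≠ P.y Q ∧
    (IsNear T A e ∧ T.Adj (P.x Q) e ∨ e = P.spare Q ∧ IsNear T B e)

lemma isSpare_spare (hQ : Q ∈ nearGulls T A B F) : P.IsSpare Q (P.spare Q) :=
  ⟨P.spare_ne_x Q hQ, P.spare_ne_y Q hQ, (P.isNear_spare Q hQ).imp_right fun h => ⟨rfl, h⟩⟩

/-- The vertex `v` of `L` is near `A` or near `B` and belongs to none of the chosen pairs. -/
def IsUnpaired (L : Finset V) (v : V) : Prop :=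
  v ∈ L ∧ (IsNear T A v ∨ IsNear T B v) ∧ ∀ Q ∈ nearGulls T A B F, v ≠ P.x Q ∧ v ≠ P.y Q

/-- `F'` is a maximum gull packing that leaves over `U` and almost all of what `F` leaves over. It
keeps the chosen pairs together, except possibly those of the gulls in `D`, and keeps the unpaired
vertices near `A` releasable. -/
structure IsRepacking (L : Finset V) (D F' : Finset (Finset V)) (U : Finset V) : Prop
    extends IsMaxGullPacking T L F' where
  subset_leftover : U ⊆ leftover L F'
  card_sdiff_le : #(leftover L F \ (leftover L F' \ U)) ≤ #U + 2
  exists_isSpare : ∀ Q ∈ nearGulls T A B F, Q ∉ D → ∃ e, {P.x Q, P.y Q, e} ∈ F' ∧ P.IsSpare Q e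
  isReleasable : ∀ v, P.IsUnpaired L v → IsNear T A v → IsReleasable T L (leftover L F) F' v

/-- The pair chosen in `Q` can be broken up: some repacking leaves over `P.x Q`, together with a
vertex that completed the pair to a gull. -/
def IsBreakable (L : Finset V) (D : Finset (Finset V)) (Q : Finset V) : Prop :=
  ∃ F' e, P.IsRepacking L D F' {P.x Q, e} ∧ P.IsSpare Q e

variable {P}

lemma IsRepacking.mono {D' : Finset (Finset V)} (h : P.IsRepacking L D F' U) (hD : D ⊆ D') :
    P.IsRepacking L D' F' U :=
  { h with exists_isSpare := fun Q hQ hQD => h.exists_isSpare Q hQ fun hQ' => hQD (hD hQ') }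

lemma IsRepacking.insert (h : P.IsRepacking L D F' U) (hf : f ∈ leftover L F') (hfU : f ∉ U) :
    P.IsRepacking L D F' (insert f U) := by
  refine { h with subset_leftover := insert_subset hf h.subset_leftover, card_sdiff_le := ?_ }
  have hsub : leftover L F \ (leftover L F' \ Insert.insert f U) ⊆
      Insert.insert f (leftover L F \ (leftover L F' \ U)) := by grind
  have hcard := (card_le_card hsub).trans (card_insert_le _ _)
  have hle := h.card_sdiff_le
  rw [card_insert_of_notMem hfU]
  omega

lemma IsBreakable.mono {D' : Finset (Finset V)} (h : P.IsBreakable L D Q) (hD : D ⊆ D') :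
    P.IsBreakable L D' Q := by
  obtain ⟨F', e, hF', he⟩ := h
  exact ⟨F', e, hF'.mono hD, he⟩

lemma isUnpaired_spare (hF : IsMaxGullPacking T L F) (hQ : Q ∈ nearGulls T A B F) :
    P.IsUnpaired L (P.spare Q) := by
  obtain ⟨hQF, hnear⟩ := mem_filter.1 hQ
  have hmem := P.spare_mem hQ
  refine ⟨hF.subset Q hQF hmem, hnear _ hmem, fun Q' hQ' => ?_⟩
  by_cases h : Q' = Q
  · subst h
    exact ⟨P.spare_ne_x Q' hQ, P.spare_ne_y Q' hQ⟩
  · have hd := disjoint_left.1 (hF.pairwiseDisjoint (mem_filter.1 hQ').1 hQF h)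
    exact ⟨fun he => hd (P.x_mem hQ') (he ▸ hmem), fun he => hd (P.y_mem hQ') (he ▸ hmem)⟩

lemma exists_mem_not_isNear (hQ : Q ∈ F) (hQn : Q ∉ nearGulls T A B F) :
    ∃ w ∈ Q, ¬ IsNear T A w ∧ ¬ IsNear T B w := by
  simpa [nearGulls, hQ] using hQn

lemma IsUnpaired.isReleasable (hT : T.CliqueFree 3) (H : HasLargeBicliqueLeftover T L F A B)
    (hv : P.IsUnpaired L v) : IsReleasable T L (leftover L F) F v := by
  rw [IsReleasable, or_iff_not_imp_left, mem_leftover]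
  intro hvF
  push Not at hvF
  obtain ⟨Q, hQ, hvQ⟩ := hvF hv.1
  refine ⟨Q, hQ, hvQ, ?_⟩
  by_cases hQn : Q ∈ nearGulls T A B F
  · have hne := hv.2.2 Q hQn
    exact H.isRobust_of_not_adj hT (mem_erase.2 ⟨hne.1.symm, P.x_mem hQn⟩)
      (mem_erase.2 ⟨hne.2.symm, P.y_mem hQn⟩) (P.isNear_x Q hQn) (P.isNear_y Q hQn)
      (P.not_adj Q hQn)
  · obtain ⟨w, hw, hwA, hwB⟩ := exists_mem_not_isNear hQ hQn
    refine H.isRobust_of_not_isNear (mem_erase.2 ⟨?_, hw⟩) hwA hwB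
    rintro rfl
    exact hv.2.1.elim hwA hwB

end Pairing

end Repacking

section Breaking

variable {V : Type*} {T : SimpleGraph V} {L Q Q' S U A B : Finset V}
  {D F F' : Finset (Finset V)} {u v f : V} {P : Pairing T A B F}

namespace Pairing

lemma x_ne_y (P : Pairing T A B F) (hT : T.CliqueFree 3)
    (H : HasLargeBicliqueLeftover T L F A B) (hQ : Q ∈ nearGulls T A B F) : P.x Q ≠ P.y Q :=
  fun hxy => H.not_isNear_right hT (P.isNear_y Q hQ) (hxy ▸ P.isNear_x Q hQ)

lemma isRepacking_self (hT : T.CliqueFree 3) (H : HasLargeBicliqueLeftover T L F A B)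
    (hu : u ∈ leftover L F) : P.IsRepacking L ∅ F {u} where
  toIsMaxGullPacking := H.toIsMaxGullPacking
  subset_leftover := singleton_subset_iff.2 hu
  card_sdiff_le := by
    have hsub : leftover L F \ (leftover L F \ {u}) ⊆ {u} := by grind
    exact (card_le_card hsub).trans (by simp)
  exists_isSpare Q hQ _ :=
    ⟨P.spare Q, P.eq_triple Q hQ ▸ (mem_filter.1 hQ).1, P.isSpare_spare hQ⟩
  isReleasable _ hv _ := hv.isReleasable hT H

lemma isRepacking_exchange (hT : T.CliqueFree 3) (H : HasLargeBicliqueLeftover T L F A B)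
    (hQ : Q ∈ F) (hS : IsGull T S) (hsub : S ⊆ Q ∪ leftover L F)
    (hrob : IsRobust T (leftover L F) (S ∩ Q)) (hSQ : ∀ v ∈ Q, P.IsUnpaired L v → v ∉ S)
    (hpair : Q ∈ nearGulls T A B F → ∃ e, S = {P.x Q, P.y Q, e} ∧ P.IsSpare Q e)
    (hu : P.IsUnpaired L u) (huQ : u ∈ Q) :
    P.IsRepacking L ∅ (Insert.insert S (F.erase Q)) {u} := by
  have hR : leftover L (Insert.insert S (F.erase Q)) = (Q ∪ leftover L F) \ S :=
    H.leftover_exchange hQ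
  have hdisj : ∀ v ∈ leftover L F, v ∉ Q := fun v hv => (mem_leftover.1 hv).2 Q hQ
  refine ⟨H.exchange hQ hS hsub, ?_, ?_, fun Q' hQ' _ => ?_, fun v hv _ => ?_⟩
  · rw [singleton_subset_iff, hR]
    exact mem_sdiff.2 ⟨mem_union_left _ huQ, hSQ u huQ hu⟩
  · have hsubS : leftover L F \ (leftover L (Insert.insert S (F.erase Q)) \ {u}) ⊆ S := by grind
    exact (card_le_card hsubS).trans hS.card_eq_three.le
  · by_cases hQQ : Q' = Q
    · subst hQQ
      obtain ⟨e, rfl, he⟩ := hpair hQ'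
      exact ⟨e, mem_insert_self _ _, he⟩
    · refine ⟨P.spare Q', ?_, P.isSpare_spare hQ'⟩
      rw [← P.eq_triple Q' hQ']
      exact mem_insert_of_mem (mem_erase.2 ⟨hQQ, (mem_filter.1 hQ').1⟩)
  · rw [IsReleasable, hR]
    rcases hv.isReleasable hT H with hvR | ⟨Q', hQ', hvQ', hrob'⟩
    · by_cases hvS : v ∈ S
      · exact .inr ⟨S, mem_insert_self _ _, hvS, hrob.mono (by grind)⟩
      · exact .inl (mem_sdiff.2 ⟨mem_union_right _ hvR, hvS⟩)
    · by_cases hQQ : Q' = Q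
      · subst hQQ
        exact .inl (mem_sdiff.2 ⟨mem_union_left _ hvQ', hSQ v hvQ' hv⟩)
      · exact .inr ⟨Q', mem_insert_of_mem (mem_erase.2 ⟨hQQ, hQ'⟩), hvQ', hrob'⟩

lemma exists_isRepacking_of_mem_nearGulls (hT : T.CliqueFree 3)
    (H : HasLargeBicliqueLeftover T L F A B) (hu : P.IsUnpaired L u)
    (hQ : Q ∈ nearGulls T A B F) (huQ : u ∈ Q) : ∃ F', P.IsRepacking L ∅ F' {u} := by
  have hQF : Q ∈ F := (mem_filter.1 hQ).1
  have hx := P.x_mem hQ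
  have hy := P.y_mem hQ
  obtain ⟨f, hf, -, hxf⟩ := H.exists_adj_right (P.isNear_x Q hQ) (Z := ∅) (by simp)
  have hfA := H.isNear_left hf
  have hfQ : f ∉ Q := (mem_leftover.1 (H.right_subset hf)).2 Q hQF
  have hgull : IsGull T {P.x Q, f, P.y Q} :=
    isGull_triple hxf (P.not_adj Q hQ) (H.not_adj_left hT hfA (P.isNear_y Q hQ))
  refine ⟨_, isRepacking_exchange hT H hQF hgull ?_ ?_ ?_ ?_ hu huQ⟩
  · simp [insert_subset_iff, H.right_subset hf, hx, hy]
  · exact H.isRobust_of_not_adj hT (by simp [hx]) (by simp [hy]) (P.isNear_x Q hQ)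
      (P.isNear_y Q hQ) (P.not_adj Q hQ)
  · intro v hvQ hv
    have hne := hv.2.2 Q hQ
    grind
  · exact fun _ => ⟨f, by rw [pair_comm], fun h => hfQ (h ▸ hx), fun h => hfQ (h ▸ hy),
      .inl ⟨hfA, hxf⟩⟩

lemma exists_isRepacking_of_notMem_nearGulls (hT : T.CliqueFree 3)
    (H : HasLargeBicliqueLeftover T L F A B) (hu : P.IsUnpaired L u) (hQ : Q ∈ F)
    (hQn : Q ∉ nearGulls T A B F) (huQ : u ∈ Q) : ∃ F', P.IsRepacking L ∅ F' {u} := by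
  obtain ⟨w, hw, hwA, hwB⟩ := exists_mem_not_isNear hQ hQn
  obtain ⟨S, hS, hsub⟩ :=
    H.isRobust_of_not_isNear (mem_singleton_self w) hwA hwB ∅ (by simp)
  rw [sdiff_empty] at hsub
  have hwS : w ∈ S := by
    by_contra hwS
    exact H.not_isGull (by grind) hS
  refine ⟨_, isRepacking_exchange hT H hQ hS ?_ ?_ ?_ (fun h => (hQn h).elim) hu huQ⟩
  · exact hsub.trans (union_subset_union_left (singleton_subset_iff.2 hw))
  · exact H.isRobust_of_not_isNear (mem_inter.2 ⟨hwS, hw⟩) hwA hwB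
  · intro v hvQ hv hvS
    rcases mem_union.1 (hsub hvS) with h | h
    · exact hv.2.1.elim (mem_singleton.1 h ▸ hwA) (mem_singleton.1 h ▸ hwB)
    · exact (mem_leftover.1 h).2 Q hQ hvQ

lemma exists_isRepacking (hT : T.CliqueFree 3) (H : HasLargeBicliqueLeftover T L F A B)
    (hu : P.IsUnpaired L u) : ∃ F', P.IsRepacking L ∅ F' {u} := by
  by_cases huR : u ∈ leftover L F
  · exact ⟨F, isRepacking_self hT H huR⟩
  obtain ⟨Q, hQ, huQ⟩ : ∃ Q ∈ F, u ∈ Q := by simpa [mem_leftover, hu.1] using huR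
  by_cases hQn : Q ∈ nearGulls T A B F
  · exact exists_isRepacking_of_mem_nearGulls hT H hu hQn huQ
  · exact exists_isRepacking_of_notMem_nearGulls hT H hu hQ hQn huQ

lemma IsRepacking.adj (hT : T.CliqueFree 3) (H : HasLargeBicliqueLeftover T L F A B)
    (h : P.IsRepacking L D F' U) (hU : #U ≤ 2) (huU : u ∈ U) (hu : IsNear T B u)
    (hv : P.IsUnpaired L v) (hvA : IsNear T A v) : T.Adj u v := by
  by_contra hadj
  have hcard := h.card_sdiff_le
  obtain ⟨F'', S, hF'', hvF, hS, hSsub, hsub⟩ := h.exists_release (h.isReleasable v hv hvA)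
    (Z := leftover L F \ (leftover L F' \ U)) (by omega) (by grind)
  obtain ⟨f, hf, hfn, huf⟩ := H.exists_adj_right hu
    (Z := leftover L F \ (leftover L F' \ U) ∪ S) ((card_union_le _ _).trans (by omega))
  have huF := h.subset_leftover huU
  have hfF := H.right_subset hf
  have huS : u ∉ S := by
    intro huS
    have := hSsub (mem_inter.2 ⟨huS, huF⟩)
    grind
  refine hF''.not_isGull ?_ (isGull_triple huf hadj (H.not_adj_left hT (H.isNear_left hf) hvA))
  simp only [insert_subset_iff, singleton_subset_iff]
  exact ⟨hsub (mem_sdiff.2 ⟨huF, huS⟩), hsub (by grind), hvF⟩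

lemma triple_ne_triple (hT : T.CliqueFree 3) (H : HasLargeBicliqueLeftover T L F A B)
    (hQ : Q ∈ nearGulls T A B F) (hQ' : Q' ∈ nearGulls T A B F) (hne : Q' ≠ Q) {e e' : V} :
    ({P.x Q', P.y Q', e'} : Finset V) ≠ {P.x Q, P.y Q, e} := by
  intro heq
  have hdisj := disjoint_left.1
    (H.pairwiseDisjoint (mem_filter.1 hQ').1 (mem_filter.1 hQ).1 hne)
  have hx : P.x Q' = e := by
    have hmem : P.x Q' ∈ ({P.x Q, P.y Q, e} : Finset V) := heq ▸ by simp
    have hnot : P.x Q' ∉ Q := hdisj (P.x_mem hQ')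
    have := P.x_mem hQ
    have := P.y_mem hQ
    grind
  have hy : P.y Q' = e := by
    have hmem : P.y Q' ∈ ({P.x Q, P.y Q, e} : Finset V) := heq ▸ by simp
    have hnot : P.y Q' ∉ Q := hdisj (P.y_mem hQ')
    have := P.x_mem hQ
    have := P.y_mem hQ
    grind
  exact H.not_isNear_right hT (P.isNear_y Q' hQ') (hy ▸ hx ▸ P.isNear_x Q' hQ')

lemma IsRepacking.leftover_exchange_pair (h : P.IsRepacking L D F' {u, f}) {x y e : V}
    (hmem : {x, y, e} ∈ F') (hxy : x ≠ y) (hey : e ≠ y) :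
    leftover L (Insert.insert {u, y, f} (F'.erase {x, y, e})) =
      {x, e} ∪ (leftover L F' \ {u, f}) := by
  have hdisj : ∀ v ∈ leftover L F', v ∉ ({x, y, e} : Finset V) :=
    fun v hv => (mem_leftover.1 hv).2 _ hmem
  have hsub := h.subset_leftover
  have := hdisj u (hsub (by simp))
  have := hdisj f (hsub (by simp))
  rw [h.leftover_exchange hmem]
  ext v
  have := hdisj v
  grind

lemma IsRepacking.isReleasable_exchange (hT : T.CliqueFree 3)
    (H : HasLargeBicliqueLeftover T L F A B) (h : P.IsRepacking L D F' {u, f})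
    (hu : IsNear T B u) (hQ : Q ∈ nearGulls T A B F) {e : V}
    (hmem : {P.x Q, P.y Q, e} ∈ F') (he : P.IsSpare Q e) (huy : ¬ T.Adj u (P.y Q))
    (hv : P.IsUnpaired L v) (hvA : IsNear T A v) :
    IsReleasable T L (leftover L F)
      (Insert.insert {u, P.y Q, f} (F'.erase {P.x Q, P.y Q, e})) v := by
  have hxy := P.x_ne_y hT H hQ
  have hvu : v ≠ u := fun hvu => H.not_isNear_right hT hvA (hvu ▸ hu)
  have hvQ := hv.2.2 Q hQ
  rw [IsReleasable, h.leftover_exchange_pair hmem hxy he.2.1]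
  rcases h.isReleasable v hv hvA with hvR | ⟨S, hS, hvS, hrob⟩
  · by_cases hvf : v = f
    · refine .inr ⟨_, mem_insert_self _ _, by simp [hvf], H.isRobust_of_not_adj hT
        (x := u) (y := P.y Q) ?_ ?_ hu (P.isNear_y Q hQ) huy⟩
      · simp [hvu.symm]
      · simp [hvQ.2.symm]
    · exact .inl (by grind)
  · by_cases hSe : S = {P.x Q, P.y Q, e}
    · exact .inl (by grind)
    · exact .inr ⟨S, mem_insert_of_mem (mem_erase.2 ⟨hSe, hS⟩), hvS, hrob⟩

lemma IsRepacking.isBreakable (hT : T.CliqueFree 3) (H : HasLargeBicliqueLeftover T L F A B)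
    (h : P.IsRepacking L D F' {u, f}) (huf : u ≠ f) (hu : IsNear T B u)
    (hQ : Q ∈ nearGulls T A B F) (hQD : Q ∉ D) (huy : ¬ T.Adj u (P.y Q))
    (hg : IsGull T {u, P.y Q, f}) : P.IsBreakable L (Insert.insert Q D) Q := by
  obtain ⟨e, hmem, he⟩ := h.exists_isSpare Q hQ hQD
  have hxy := P.x_ne_y hT H hQ
  have hR := h.leftover_exchange_pair hmem hxy he.2.1
  have hdisj : ∀ v ∈ leftover L F', v ∉ ({P.x Q, P.y Q, e} : Finset V) :=
    fun v hv => (mem_leftover.1 hv).2 _ hmem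
  have hsub := h.subset_leftover
  refine ⟨_, e, ⟨h.exchange hmem hg (by grind), by grind, ?_, fun Q' hQ' hQD' => ?_,
    fun v hv hvA => h.isReleasable_exchange hT H hu hQ hmem he huy hv hvA⟩, he⟩
  · have hcard := h.card_sdiff_le
    rw [card_pair huf] at hcard
    rw [card_pair he.1.symm, hR]
    exact (card_le_card (by grind)).trans hcard
  · rw [mem_insert, not_or] at hQD'
    obtain ⟨e', hmem', he'⟩ := h.exists_isSpare Q' hQ' hQD'.2
    exact ⟨e', mem_insert_of_mem (mem_erase.2 ⟨triple_ne_triple hT H hQ hQ' hQD'.1, hmem'⟩), he'⟩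

lemma IsUnpaired.isBreakable (hT : T.CliqueFree 3) (H : HasLargeBicliqueLeftover T L F A B)
    (hu : P.IsUnpaired L u) (huB : IsNear T B u) (hQ : Q ∈ nearGulls T A B F) (hQD : Q ∉ D)
    (huy : ¬ T.Adj u (P.y Q)) : P.IsBreakable L (Insert.insert Q D) Q := by
  obtain ⟨F', h⟩ := exists_isRepacking hT H hu
  have hcard := h.card_sdiff_le
  rw [card_singleton] at hcard
  obtain ⟨f, hf, hfn, huf⟩ := H.exists_adj_right huB
    (Z := leftover L F \ (leftover L F' \ {u})) (by omega)
  have hfR := H.right_subset hf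
  have h' := (h.mono (empty_subset D)).insert (f := f) (by grind) (by simpa using huf.ne')
  rw [pair_comm] at h'
  refine h'.isBreakable hT H huf.ne huB hQ hQD huy ?_
  rw [pair_comm]
  exact isGull_triple huf huy (H.not_adj_left hT (H.isNear_left hf) (P.isNear_y Q hQ))

lemma IsBreakable.step (hT : T.CliqueFree 3) (H : HasLargeBicliqueLeftover T L F A B)
    (h : P.IsBreakable L D Q') (hQ' : Q' ∈ nearGulls T A B F) (hQ : Q ∈ nearGulls T A B F)
    (hQD : Q ∉ D) (hxy : ¬ T.Adj (P.x Q') (P.y Q)) :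
    P.IsBreakable L (Insert.insert Q D) Q := by
  obtain ⟨F', e, hF', hex, -, he⟩ := h
  have hx := P.isNear_x Q' hQ'
  have hy := P.isNear_y Q hQ
  rcases he with ⟨heA, hadj⟩ | ⟨rfl, heB⟩
  · refine hF'.isBreakable hT H hex.symm hx hQ hQD hxy ?_
    rw [pair_comm]
    exact isGull_triple hadj hxy (H.not_adj_left hT heA hy)
  · by_cases hsy : T.Adj (P.spare Q') (P.y Q)
    · refine hF'.isBreakable hT H hex.symm hx hQ hQD hxy ?_
      have hg := isGull_triple hsy (H.not_adj_right hT heB hx) (fun h => hxy h.symm)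
      convert hg using 1
      grind
    · exact (isUnpaired_spare H.toIsMaxGullPacking hQ').isBreakable hT H heB hQ hQD hsy

end Pairing

end Breaking

section Closure

variable {V : Type*} {T : SimpleGraph V} {L Q A B : Finset V} {D F : Finset (Finset V)}
  {u v : V} {P : Pairing T A B F} {d : Finset V → V}

namespace Pairing

lemma exists_maximal_isBreakable (P : Pairing T A B F) (L : Finset V) :
    ∃ D : Finset (Finset V), (∀ Q ∈ D, Q ∈ nearGulls T A B F ∧ P.IsBreakable L D Q) ∧
      ∀ Q ∈ nearGulls T A B F, Q ∉ D → ¬ P.IsBreakable L (insert Q D) Q := by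
  obtain ⟨D, hD, hmax⟩ := exists_max_image
    {D ∈ (nearGulls T A B F).powerset | ∀ Q ∈ D, P.IsBreakable L D Q} card ⟨∅, by simp⟩
  rw [mem_filter, mem_powerset] at hD
  refine ⟨D, fun Q hQ => ⟨hD.1 hQ, hD.2 Q hQ⟩, fun Q hQ hQD hbr => ?_⟩
  have hle := hmax (insert Q D) (mem_filter.2 ⟨mem_powerset.2 (insert_subset hQ hD.1), ?_⟩)
  · rw [card_insert_of_notMem hQD] at hle
    omega
  · rw [forall_mem_insert]
    exact ⟨hbr, fun Q' hQ' => (hD.2 Q' hQ').mono (subset_insert _ _)⟩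

/-- A choice of one vertex `d Q` in each gull of `F` whose removal leaves a biclique: one of the two
paired vertices, according to whether `Q ∈ D`, or a vertex that is near neither side. -/
structure IsRemoval (P : Pairing T A B F) (D : Finset (Finset V)) (d : Finset V → V) : Prop where
  mem : ∀ Q ∈ F, d Q ∈ Q
  eq_y : ∀ Q ∈ nearGulls T A B F, Q ∈ D → d Q = P.y Q
  eq_x : ∀ Q ∈ nearGulls T A B F, Q ∉ D → d Q = P.x Q
  not_isNear : ∀ Q ∈ F, Q ∉ nearGulls T A B F → ¬ IsNear T A (d Q) ∧ ¬ IsNear T B (d Q)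

lemma exists_isRemoval (P : Pairing T A B F) (D : Finset (Finset V)) : ∃ d, P.IsRemoval D d := by
  have : Nonempty V := ⟨P.x ∅⟩
  choose! w hw using fun Q (hQ : Q ∈ F ∧ Q ∉ nearGulls T A B F) =>
    exists_mem_not_isNear hQ.1 hQ.2
  refine ⟨fun Q => if Q ∈ nearGulls T A B F then (if Q ∈ D then P.y Q else P.x Q) else w Q,
    fun Q hQ => ?_, fun Q hQ hD => by simp only [hQ, hD, if_true],
    fun Q hQ hD => by simp only [hQ, hD, if_true, if_false], fun Q hQ hQn => ?_⟩
  · split_ifs with hQn hD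
    · exact P.y_mem hQn
    · exact P.x_mem hQn
    · exact (hw Q ⟨hQ, hQn⟩).1
  · simpa only [hQn, if_false] using (hw Q ⟨hQ, hQn⟩).2

namespace IsRemoval

lemma isNear_or_isNear (hd : P.IsRemoval D d) (H : HasLargeBicliqueLeftover T L F A B)
    (hv : v ∈ L \ F.image d) : IsNear T A v ∨ IsNear T B v := by
  rw [Finset.mem_sdiff] at hv
  by_contra! hfar
  obtain ⟨Q, hQ, hvQ⟩ : ∃ Q ∈ F, v ∈ Q := by
    have hvR : v ∉ leftover L F := fun h => not_or.2 hfar (H.isNear_or_isNear h)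
    simpa [mem_leftover, hv.1] using hvR
  have hQn : Q ∉ nearGulls T A B F := fun h => not_or.2 hfar ((mem_filter.1 h).2 v hvQ)
  have hne : v ≠ d Q := fun h => hv.2 (mem_image.2 ⟨Q, hQ, h.symm⟩)
  have hfar' := hd.not_isNear Q hQ hQn
  -- Two vertices of one gull that are near neither side yield two disjoint gulls.
  exact H.not_isRobust hQ (singleton_subset_iff.2 hvQ) (singleton_subset_iff.2 (hd.mem Q hQ))
    (disjoint_singleton.2 hne)
    (H.isRobust_of_not_isNear (mem_singleton_self v) hfar.1 hfar.2)
    (H.isRobust_of_not_isNear (mem_singleton_self _) hfar'.1 hfar'.2)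

lemma leftover_subset (hd : P.IsRemoval D d) : leftover L F ⊆ L \ F.image d := by
  intro v hv
  refine Finset.mem_sdiff.2 ⟨_root_.leftover_subset hv, fun h => ?_⟩
  obtain ⟨Q, hQ, rfl⟩ := mem_image.1 h
  exact (mem_leftover.1 hv).2 Q hQ (hd.mem Q hQ)

lemma isUnpaired_or_eq_x (hd : P.IsRemoval D d) (hT : T.CliqueFree 3)
    (H : HasLargeBicliqueLeftover T L F A B) (hu : u ∈ L \ F.image d) (huB : IsNear T B u) :
    P.IsUnpaired L u ∨ ∃ Q ∈ nearGulls T A B F, Q ∈ D ∧ u = P.x Q := by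
  rw [Finset.mem_sdiff] at hu
  by_cases! h : ∃ Q ∈ nearGulls T A B F, u = P.x Q
  · obtain ⟨Q, hQ, rfl⟩ := h
    refine .inr ⟨Q, hQ, ?_, rfl⟩
    by_contra hQD
    exact hu.2 (mem_image.2 ⟨Q, (mem_filter.1 hQ).1, hd.eq_x Q hQ hQD⟩)
  · refine .inl ⟨hu.1, .inr huB, fun Q hQ => ⟨h Q hQ, ?_⟩⟩
    rintro rfl
    exact H.not_isNear_right hT (P.isNear_y Q hQ) huB

lemma isUnpaired_or_eq_y (hd : P.IsRemoval D d) (hT : T.CliqueFree 3)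
    (H : HasLargeBicliqueLeftover T L F A B) (hv : v ∈ L \ F.image d) (hvA : IsNear T A v) :
    P.IsUnpaired L v ∨ ∃ Q ∈ nearGulls T A B F, Q ∉ D ∧ v = P.y Q := by
  rw [Finset.mem_sdiff] at hv
  by_cases! h : ∃ Q ∈ nearGulls T A B F, v = P.y Q
  · obtain ⟨Q, hQ, rfl⟩ := h
    refine .inr ⟨Q, hQ, fun hQD => ?_, rfl⟩
    exact hv.2 (mem_image.2 ⟨Q, (mem_filter.1 hQ).1, hd.eq_y Q hQ hQD⟩)
  · refine .inl ⟨hv.1, .inl hvA, fun Q hQ => ⟨?_, h Q hQ⟩⟩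
    rintro rfl
    exact H.not_isNear_right hT hvA (P.isNear_x Q hQ)

lemma adj (hd : P.IsRemoval D d) (hT : T.CliqueFree 3)
    (H : HasLargeBicliqueLeftover T L F A B) (hD : ∀ Q ∈ D, P.IsBreakable L D Q)
    (hmax : ∀ Q ∈ nearGulls T A B F, Q ∉ D → ¬ P.IsBreakable L (insert Q D) Q)
    (hu : u ∈ L \ F.image d) (huB : IsNear T B u) (hv : v ∈ L \ F.image d) (hvA : IsNear T A v) :
    T.Adj u v := by
  rcases hd.isUnpaired_or_eq_y hT H hv hvA with hv' | ⟨Q, hQ, hQD, rfl⟩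
  · rcases hd.isUnpaired_or_eq_x hT H hu huB with hu' | ⟨Q, -, hQD, rfl⟩
    · obtain ⟨F', hF'⟩ := exists_isRepacking hT H hu'
      exact hF'.adj hT H (by simp) (mem_singleton_self u) huB hv' hvA
    · obtain ⟨F', e, hF', -⟩ := hD Q hQD
      exact hF'.adj hT H card_le_two (mem_insert_self _ _) huB hv' hvA
  · by_contra hadj
    rcases hd.isUnpaired_or_eq_x hT H hu huB with hu' | ⟨Q', hQ', hQ'D, rfl⟩
    · exact hmax Q hQ hQD (hu'.isBreakable hT H huB hQ hQD hadj)
    · exact hmax Q hQ hQD ((hD Q' hQ'D).step hT H hQ' hQ hQD hadj)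

end IsRemoval

end Pairing

lemma HasLargeBicliqueLeftover.exists_isCompleteBetween (hT : T.CliqueFree 3)
    (H : HasLargeBicliqueLeftover T L F A B) :
    ∃ X Y : Finset V, X ⊆ L ∧ Y ⊆ L ∧ X.Nonempty ∧ Y.Nonempty ∧ T.IsCompleteBetween X Y ∧
      #L ≤ #X + #Y + #F := by
  obtain ⟨P⟩ := H.nonempty_pairing hT
  obtain ⟨D, hD, hmax⟩ := P.exists_maximal_isBreakable L
  obtain ⟨d, hd⟩ := P.exists_isRemoval D
  have hA : A.Nonempty := card_pos.1 (by have := H.thirty_le_left; omega)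
  have hB : B.Nonempty := card_pos.1 (by have := H.thirty_le_right; omega)
  refine ⟨{v ∈ L \ F.image d | IsNear T B v}, {v ∈ L \ F.image d | IsNear T A v},
    (filter_subset _ _).trans sdiff_subset, (filter_subset _ _).trans sdiff_subset,
    ?_, ?_, fun u hu v hv => ?_, ?_⟩
  · exact hA.imp fun a ha => mem_filter.2
      ⟨hd.leftover_subset (H.left_subset ha), H.isNear_right ha⟩
  · exact hB.imp fun b hb => mem_filter.2
      ⟨hd.leftover_subset (H.right_subset hb), H.isNear_left hb⟩
  · rw [mem_coe, mem_filter] at hu hv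
    exact hd.adj hT H (fun Q hQ => (hD Q hQ).2) hmax hu.1 hu.2 hv.1 hv.2
  · have hcover : L \ F.image d ⊆
        {v ∈ L \ F.image d | IsNear T B v} ∪ {v ∈ L \ F.image d | IsNear T A v} := fun v hv => by
      rw [mem_union, mem_filter, mem_filter]
      exact (hd.isNear_or_isNear H hv).symm.imp (fun h => ⟨hv, h⟩) fun h => ⟨hv, h⟩
    have hcard := (card_le_card hcover).trans (card_union_le _ _)
    have hsdiff := le_card_sdiff (F.image d) L
    have himage := card_image_le (s := F) (f := d)
    omega

lemma exists_isGullPacking (hT : T.CliqueFree 3) {k : ℕ} (hL : 3 * k ≤ #L)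
    (hind : ∀ I ⊆ L, T.IsIndepSet (I : Set V) → #I + 2 * k ≤ #L)
    (hbic : ∀ X ⊆ L, ∀ Y ⊆ L, X.Nonempty → Y.Nonempty → T.IsCompleteBetween X Y →
      #X + #Y + k ≤ #L) :
    ∃ F, IsGullPacking T L F ∧ #F ≤ k ∧ k ≤ #F + 40 := by
  obtain ⟨F, A, B, h, hBA⟩ := exists_isBalancedPacking hT L
  have hk : k ≤ #F + 40 := by
    by_contra! hk
    have hcard := h.card_add
    by_cases hB : 30 ≤ #B
    · obtain ⟨X, Y, hX, hY, hXn, hYn, hXY, hc⟩ :=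
        HasLargeBicliqueLeftover.exists_isCompleteBetween hT
          ⟨h.toHasBicliqueLeftover, hB.trans hBA, hB⟩
      have := hbic X hX Y hY hXn hYn hXY
      omega
    · obtain ⟨I, hI, hIind, hIcard⟩ := h.exists_isIndepSet h.left_subset h.isIndepSet_left
        fun Q hQ => h.exists_isSwappable hT (by omega) (by omega) hQ
      have := hind I hI hIind
      omega
  obtain ⟨F', hF', hcard⟩ := exists_subset_card_eq (min_le_right k #F)
  exact ⟨F', h.mono hF', by omega, by omega⟩

end Closure

section Minors

variable {V W W' α : Type*} {G : SimpleGraph V} {H : SimpleGraph W} {H' : SimpleGraph W'}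
  {A S S' : Finset V} {B C : Finset (Finset V)} {m : ℕ}

lemma isMinor_of_isContained (hH : H.IsMinor G) (h : H'.IsContained H) :
    H'.IsMinor G := by
  obtain ⟨φ⟩ := h
  obtain ⟨B, hconn, hdisj, hadj⟩ := hH
  exact ⟨B ∘ φ, fun w => hconn (φ w), fun u w huw => hdisj _ _ (φ.injective.ne huw),
    fun u w huw => hadj _ _ (φ.toHom.map_adj huw)⟩

/-- The graph on the finite sets of vertices of `G` in which two distinct sets are adjacent when
some edge of `G` joins them. It records the adjacencies that branch sets acquire in a minor. -/
def touchGraph (G : SimpleGraph V) : SimpleGraph (Finset V) where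
  Adj S S' := S ≠ S' ∧ ∃ u ∈ S, ∃ v ∈ S', G.Adj u v
  symm := ⟨fun _ _ ⟨hne, u, hu, v, hv, h⟩ => ⟨hne.symm, v, hv, u, hu, h.symm⟩⟩
  loopless := ⟨fun _ h => h.1 rfl⟩

lemma compl_adj_of_compl_touchGraph_adj (h : (touchGraph G)ᶜ.Adj S S') (hd : Disjoint S S')
    {u v : V} (hu : u ∈ S) (hv : v ∈ S') : Gᶜ.Adj u v :=
  ⟨disjoint_iff_ne.1 hd u hu v hv, fun hadj => h.2 ⟨h.1, u, hu, v, hv, hadj⟩⟩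

/-- A family of pairwise disjoint connected vertex sets of `G`, ready to be the branch sets of a
minor. -/
structure IsBranchFamily (G : SimpleGraph V) (B : Finset (Finset V)) : Prop where
  connected : ∀ S ∈ B, (G.induce (S : Set V)).Connected
  pairwiseDisjoint : (B : Set (Finset V)).PairwiseDisjoint id

lemma connected_induce_singleton (v : V) : (G.induce {v}).Connected := by
  have : Unique ↥({v} : Set V) := Set.uniqueSingleton v
  exact ⟨.of_subsingleton⟩

lemma isBranchFamily_singletons (A : Finset V) :
    IsBranchFamily G (A.image fun v => {v}) where
  connected := by
    rw [forall_mem_image]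
    intro v _
    rw [coe_singleton]
    exact connected_induce_singleton v
  pairwiseDisjoint := by
    rw [coe_image]
    rintro _ ⟨u, -, rfl⟩ _ ⟨v, -, rfl⟩ huv
    exact disjoint_singleton.2 fun h => huv (congrArg _ h)

namespace IsBranchFamily

lemma mono (hB : IsBranchFamily G B) (h : C ⊆ B) : IsBranchFamily G C :=
  ⟨fun S hS => hB.connected S (h hS), hB.pairwiseDisjoint.subset (coe_subset.2 h)⟩

protected lemma union (hB : IsBranchFamily G B) (hC : IsBranchFamily G C)
    (h : ∀ S ∈ B, ∀ S' ∈ C, Disjoint S S') : IsBranchFamily G (B ∪ C) where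
  connected := fun S hS => (mem_union.1 hS).elim (hB.connected S) (hC.connected S)
  pairwiseDisjoint := by
    have : Std.Symm (Function.onFun Disjoint (id : Finset V → Finset V)) :=
      ⟨fun _ _ h => Disjoint.symm h⟩
    rw [coe_union, Set.PairwiseDisjoint,
      Set.pairwise_union_of_symm]
    exact ⟨hB.pairwiseDisjoint, hC.pairwiseDisjoint, fun S hS S' hS' _ => h S hS S' hS'⟩

lemma nonempty (hB : IsBranchFamily G B) (hS : S ∈ B) : S.Nonempty := by
  obtain ⟨x, hx⟩ := (hB.connected S hS).nonempty
  exact ⟨x, hx⟩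

lemma disjoint_of_forall_disjoint (hB : IsBranchFamily G B)
    (h : ∀ S ∈ B, ∀ S' ∈ C, Disjoint S S') : Disjoint B C :=
  disjoint_left.2 fun S hS hS' =>
    (hB.nonempty hS).ne_empty (disjoint_self_iff_empty S |>.1 (h S hS S hS'))

lemma isMinor_induce (hB : IsBranchFamily G B) :
    ((touchGraph G).induce (B : Set (Finset V))).IsMinor G :=
  ⟨fun S => (S.1 : Set V), fun S => hB.connected S S.2,
    fun S S' h => disjoint_coe.2 (hB.pairwiseDisjoint S.2 S'.2 (Subtype.coe_ne_coe.2 h)),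
    fun _ _ h => h.2⟩

end IsBranchFamily

lemma card_mul_card_sub_one_eq (K : SimpleGraph α) [DecidableRel Kᶜ.Adj] (B : Finset α) :
    #B * (#B - 1) =
      2 * (K.induce (B : Set α)).edgeSet.ncard + #(Kᶜ.interedges B B) := by
  have hedges : 2 * (K.induce (B : Set α)).edgeSet.ncard = #(K.interedges B B) := by
    rw [← SimpleGraph.coe_edgeFinset, Set.ncard_coe_finset, SimpleGraph.two_mul_card_edgeFinset]
    refine card_bij (fun p _ => (p.1.1, p.2.1)) ?_ ?_ ?_
    · rintro ⟨⟨u, hu⟩, ⟨v, hv⟩⟩ h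
      exact (SimpleGraph.mem_interedges_iff _).2 ⟨hu, hv, (mem_filter.1 h).2⟩
    · rintro ⟨u, v⟩ - ⟨u', v'⟩ - h
      simpa only [Prod.mk.injEq, Subtype.ext_iff] using h
    · rintro ⟨u, v⟩ h
      obtain ⟨hu, hv, huv⟩ := (SimpleGraph.mem_interedges_iff _).1 h
      exact ⟨(⟨u, hu⟩, ⟨v, hv⟩), mem_filter.2 ⟨mem_univ _, huv⟩, rfl⟩
  have hdisj : Disjoint (K.interedges B B) (Kᶜ.interedges B B) := by
    rw [disjoint_left]
    intro p hp hp'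
    rw [SimpleGraph.mem_interedges_iff] at hp hp'
    exact hp'.2.2.2 hp.2.2
  rw [hedges, ← card_union_of_disjoint hdisj, Nat.mul_sub_one, ← offDiag_card]
  congr 1
  ext ⟨u, v⟩
  have := K.ne_of_adj (a := u) (b := v)
  simp only [mem_offDiag, mem_union, SimpleGraph.mem_interedges_iff, SimpleGraph.compl_adj]
  tauto

lemma interedges_subset_union [DecidableEq α] (K : SimpleGraph α) [DecidableRel K.Adj]
    (B C : Finset α) :
    K.interedges C C ⊆ K.interedges B B ∪ ((C \ B) ×ˢ C ∪ C ×ˢ (C \ B)) := by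
  rintro ⟨u, v⟩ h
  simp only [mem_union, SimpleGraph.mem_interedges_iff, mem_product, Finset.mem_sdiff] at h ⊢
  tauto

namespace IsBranchFamily

lemma exists_isMinor_card (hB : IsBranchFamily G B) :
    ∃ H : SimpleGraph (Fin #B), H.IsMinor G ∧
      #B * (#B - 1) = 2 * H.edgeSet.ncard + #((touchGraph G)ᶜ.interedges B B) := by
  let K := (touchGraph G).induce (B : Set (Finset V))
  let φ : K ≃g K.overFin (Fintype.card_coe B) := K.overFinIso _
  refine ⟨_, isMinor_of_isContained hB.isMinor_induce ⟨φ.symm.toCopy⟩, ?_⟩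
  have hedges : K.edgeSet.ncard = (K.overFin (Fintype.card_coe B)).edgeSet.ncard :=
    Nat.card_congr φ.mapEdgeSet
  rw [card_mul_card_sub_one_eq (touchGraph G) B, hedges]

lemma exists_card_eq [Fintype V] (hB : IsBranchFamily G B) (hm : m ≤ #B + #(leftover univ B)) :
    ∃ C, IsBranchFamily G C ∧ #C = m ∧ #(C \ B) ≤ m - #B := by
  rcases le_total m #B with h | h
  · obtain ⟨C, hC, hc⟩ := exists_subset_card_eq h
    refine ⟨C, hB.mono hC, hc, ?_⟩
    rw [sdiff_eq_empty_iff_subset.2 hC, card_empty]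
    exact Nat.zero_le _
  · obtain ⟨A, hA, hc⟩ := exists_subset_card_eq (Nat.sub_le_iff_le_add'.2 hm)
    have hBA : ∀ S ∈ B, ∀ S' ∈ A.image fun v => {v}, Disjoint S S' := fun S hS => by
      rw [forall_mem_image]
      exact fun v hv => disjoint_singleton_right.2 ((mem_leftover.1 (hA hv)).2 S hS)
    have hcard : #(A.image fun v => ({v} : Finset V)) = m - #B := by
      rw [card_image_of_injective _ singleton_injective, hc]
    refine ⟨_, hB.union (isBranchFamily_singletons A) hBA, ?_, ?_⟩
    · rw [card_union_of_disjoint (hB.disjoint_of_forall_disjoint hBA), hcard]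
      omega
    · rw [union_sdiff_left, ← hcard]
      exact card_le_card sdiff_subset

lemma exists_isMinor [Fintype V] (hB : IsBranchFamily G B) (hm : m ≤ #B + #(leftover univ B)) :
    ∃ H : SimpleGraph (Fin m), H.IsMinor G ∧
      m * (m - 1) ≤ 2 * H.edgeSet.ncard + #((touchGraph G)ᶜ.interedges B B) +
        2 * (m * (m - #B)) := by
  obtain ⟨C, hC, rfl, hCB⟩ := hB.exists_card_eq hm
  obtain ⟨H, hH, hcard⟩ := hC.exists_isMinor_card
  refine ⟨H, hH, ?_⟩
  have hmissing := card_le_card (interedges_subset_union (touchGraph G)ᶜ B C)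
  have hunion := (card_union_le ((touchGraph G)ᶜ.interedges B B) _).trans
    (Nat.add_le_add_left (card_union_le ((C \ B) ×ˢ C) (C ×ˢ (C \ B))) _)
  rw [card_product, card_product, mul_comm #(C \ B)] at hunion
  have hnew := Nat.mul_le_mul_left #C hCB
  omega

end IsBranchFamily

lemma IsGull.connected_induce (h : IsGull Gᶜ S) : (G.induce (S : Set V)).Connected := by
  obtain ⟨a, b, c, hab, hac, hbc, rfl⟩ := h
  have hne_ac : a ≠ c := fun h => hbc (h ▸ hab.symm)
  have hne_bc : b ≠ c := fun h => hac (h ▸ hab)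
  have hGac : G.Adj a c := by_contra fun h => hac ⟨hne_ac, h⟩
  have hGcb : G.Adj c b := by_contra fun h => hbc ⟨hne_bc, fun h' => h h'.symm⟩
  have hset : (({a, b, c} : Finset V) : Set V) = {a, c} ∪ {c, b} := by
    ext x
    simp only [coe_insert, coe_singleton, Set.mem_insert_iff, Set.mem_singleton_iff, Set.mem_union]
    tauto
  rw [hset]
  exact SimpleGraph.induce_union_connected (G.induce_pair_connected_of_adj hGac).preconnected
    (G.induce_pair_connected_of_adj hGcb).preconnected ⟨c, by simp, by simp⟩

lemma IsGull.exists_adj (hT : Gᶜ.CliqueFree 3) (h : IsGull Gᶜ S) (hd : Disjoint S S') {v : V}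
    (hv : v ∈ S') : ∃ u ∈ S, G.Adj u v := by
  obtain ⟨a, b, c, hab, -, -, rfl⟩ := h
  have hav : a ≠ v := fun h => disjoint_left.1 hd (by simp) (h ▸ hv)
  have hbv : b ≠ v := fun h => disjoint_left.1 hd (by simp) (h ▸ hv)
  by_contra! hno
  exact not_adj_of_triangleFree hT hab ⟨hbv, hno b (by simp)⟩ ⟨hav, hno a (by simp)⟩

lemma IsGullPacking.isBranchFamily {L : Finset V} (hB : IsGullPacking Gᶜ L B) :
    IsBranchFamily G B :=
  ⟨fun S hS => (hB.isGull S hS).connected_induce, hB.pairwiseDisjoint⟩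

end Minors

section CompleteMinors

variable {V : Type*} {G T : SimpleGraph V} {A B S X Y : Finset V} {m : ℕ}

lemma isIndepSet_of_isCompleteBetween (hT : T.CliqueFree 3) (h : T.IsCompleteBetween A B)
    (hB : B.Nonempty) : T.IsIndepSet (A : Set V) := by
  obtain ⟨b, hb⟩ := hB
  exact fun u hu v hv _ => not_adj_of_triangleFree hT (h hu hb) (h hv hb).symm

lemma isMinor_top_of_matching (hA : G.IsClique A) (hB : G.IsClique B)
    (hAS : G.IsCompleteBetween A S) (hAB : Disjoint A B) (hSB : Disjoint S B) {f : S → V}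
    (hf : Function.Injective f) (hfB : ∀ s, f s ∈ B) (hadj : ∀ s : S, G.Adj s (f s)) :
    (⊤ : SimpleGraph (A ⊕ S)).IsMinor G := by
  have hAf : ∀ a ∈ A, ∀ s, a ≠ f s := fun a ha s h => disjoint_left.1 hAB ha (h ▸ hfB s)
  have hSf : ∀ s' ∈ S, ∀ s, s' ≠ f s := fun s' hs' s h => disjoint_left.1 hSB hs' (h ▸ hfB s)
  refine ⟨Sum.elim (fun a => {a.1}) fun s => {s.1, f s}, ?_, ?_, ?_⟩
  · rintro (a | s)
    · exact connected_induce_singleton a.1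
    · exact G.induce_pair_connected_of_adj (hadj s)
  · have hAS_disj : ∀ (a : A) (s : S), Disjoint ({a.1} : Set V) {s.1, f s} := fun a s => by
      rw [Set.disjoint_singleton_left]
      rintro (h | h)
      · exact (hAS a.2 s.2).ne h
      · exact hAf a a.2 s h
    rintro (a | s) (a' | s') hne
    · exact Set.disjoint_singleton.2 fun h => hne (congrArg _ (Subtype.ext h))
    · exact hAS_disj a s'
    · exact (hAS_disj a' s).symm
    · have hss : s ≠ s' := fun h => hne (congrArg _ h)
      simp only [Sum.elim_inr, Set.disjoint_insert_left, Set.disjoint_singleton_left,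
        Set.mem_insert_iff, Set.mem_singleton_iff, not_or]
      exact ⟨⟨Subtype.coe_ne_coe.2 hss, hSf s s.2 s'⟩, (hSf s' s'.2 s).symm, hf.ne hss⟩
  · rintro (a | s) (a' | s') hne
    · exact ⟨a, rfl, a', rfl, hA a.2 a'.2 fun h => hne (congrArg _ (Subtype.ext h))⟩
    · exact ⟨a, rfl, s', .inl rfl, hAS a.2 s'.2⟩
    · exact ⟨s, .inl rfl, a', rfl, (hAS a'.2 s.2).symm⟩
    · refine ⟨f s, .inr rfl, f s', .inr rfl, hB (hfB s) (hfB s') ?_⟩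
      exact hf.ne fun h => hne (congrArg _ h)

/-- A pair of nonempty vertex sets, completely joined to each other in `T`, of largest total size
among all such pairs. -/
structure IsMaxCompletePair (T : SimpleGraph V) (A B : Finset V) : Prop where
  left_nonempty : A.Nonempty
  right_nonempty : B.Nonempty
  isCompleteBetween : T.IsCompleteBetween A B
  card_le : ∀ X Y : Finset V, X.Nonempty → Y.Nonempty → T.IsCompleteBetween X Y →
    #X + #Y ≤ #A + #B

lemma exists_isMaxCompletePair [Finite V] (hX : X.Nonempty) (hY : Y.Nonempty)
    (hXY : T.IsCompleteBetween X Y) : ∃ A B, IsMaxCompletePair T A B := by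
  cases nonempty_fintype V
  let P : Finset (Finset V × Finset V) :=
    {p | p.1.Nonempty ∧ p.2.Nonempty ∧ T.IsCompleteBetween p.1 p.2}
  have hP : P.Nonempty := ⟨(X, Y), by simpa [P] using ⟨hX, hY, hXY⟩⟩
  obtain ⟨⟨A, B⟩, hAB, hmax⟩ := exists_max_image P (fun p => #p.1 + #p.2) hP
  obtain ⟨hA, hB, hAB⟩ := (mem_filter.1 hAB).2
  exact ⟨A, B, hA, hB, hAB, fun X Y hX hY hXY => hmax (X, Y) (by simpa [P] using ⟨hX, hY, hXY⟩)⟩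

namespace IsMaxCompletePair

lemma symm (h : IsMaxCompletePair T A B) : IsMaxCompletePair T B A :=
  ⟨h.right_nonempty, h.left_nonempty, h.isCompleteBetween.symm, by
    simpa only [add_comm #B] using h.card_le⟩

-- If Hall's condition failed for `X`, then `A ∪ X` and `B \ N(X)` would be a larger complete pair.
lemma exists_matching (h : IsMaxCompletePair Gᶜ A B) (hSA : Disjoint S A) (hSB : Disjoint S B)
    (hcard : #S ≤ #B) :
    ∃ f : S → V, Function.Injective f ∧ ∀ s, f s ∈ B ∧ G.Adj s (f s) := by
  suffices hall : ∀ X : Finset S, #X ≤ #(X.biUnion fun s => {b ∈ B | G.Adj s b}) by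
    simpa only [mem_filter] using (all_card_le_biUnion_card_iff_exists_injective _).1 hall
  intro X
  by_contra! hlt
  set N := X.biUnion fun s => {b ∈ B | G.Adj s b}
  have hNB : N ⊆ B := biUnion_subset.2 fun s _ => filter_subset _ _
  have hXS : #X ≤ #S := (card_le_univ X).trans_eq (Fintype.card_coe S)
  have hne : (B \ N).Nonempty := by
    rw [← card_pos, card_sdiff_of_subset hNB]
    omega
  have hcomplete : Gᶜ.IsCompleteBetween ↑(A ∪ X.map (.subtype _)) ↑(B \ N) := by
    intro u hu b hb
    obtain ⟨hbB, hbN⟩ := Finset.mem_sdiff.1 hb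
    rcases mem_union.1 hu with hu | hu
    · exact h.isCompleteBetween hu hbB
    · obtain ⟨s, hs, rfl⟩ := mem_map.1 hu
      refine ⟨fun hsb => disjoint_left.1 hSB s.2 (by subst hsb; exact hbB), fun hadj => hbN ?_⟩
      exact mem_biUnion.2 ⟨s, hs, mem_filter.2 ⟨hbB, hadj⟩⟩
  have hAX : Disjoint A (X.map (.subtype _)) := by
    rw [disjoint_left]
    rintro v hv hv'
    obtain ⟨s, -, rfl⟩ := mem_map.1 hv'
    exact disjoint_left.1 hSA s.2 hv
  have hle := h.card_le _ _ (h.left_nonempty.mono subset_union_left) hne hcomplete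
  rw [card_union_of_disjoint hAX, card_map, card_sdiff_of_subset hNB] at hle
  have := card_le_card hNB
  omega

lemma isMinor_top (hT : Gᶜ.CliqueFree 3) (h : IsMaxCompletePair Gᶜ A B) (hSA : Disjoint S A)
    (hSB : Disjoint S B) (hadj : ∀ s ∈ S, ∀ a ∈ A, ¬ Gᶜ.Adj s a) (hmS : m ≤ #A + #S)
    (hmB : m ≤ #A + #B) : (⊤ : SimpleGraph (Fin m)).IsMinor G := by
  obtain ⟨S', hS', hcard⟩ := exists_subset_card_eq (min_le_left #S #B)
  obtain ⟨f, hf, hfB⟩ := h.exists_matching (hSA.mono_left hS') (hSB.mono_left hS') (by omega)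
  have hAS : G.IsCompleteBetween A S' := fun a ha s hs => by_contra fun hne =>
    hadj s (hS' hs) a ha ⟨fun hsa => disjoint_left.1 hSA (hS' hs) (hsa ▸ ha), fun h => hne h.symm⟩
  have hA : G.IsClique A := (SimpleGraph.isIndepSet_compl _).1
    (isIndepSet_of_isCompleteBetween hT h.isCompleteBetween h.right_nonempty)
  have hB : G.IsClique B := (SimpleGraph.isIndepSet_compl _).1
    (isIndepSet_of_isCompleteBetween hT h.isCompleteBetween.symm h.left_nonempty)
  have hminor := isMinor_top_of_matching hA hB hAS
    (disjoint_coe.1 h.isCompleteBetween.disjoint) (hSB.mono_left hS') hf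
    (fun s => (hfB s).1) fun s => (hfB s).2
  obtain ⟨e⟩ := Function.Embedding.nonempty_of_card_le (α := Fin m) (β := A ⊕ S') (by
    rw [Fintype.card_fin, Fintype.card_sum, Fintype.card_coe, Fintype.card_coe]
    omega)
  exact isMinor_of_isContained hminor ⟨(SimpleGraph.Embedding.completeGraph e).toCopy⟩

end IsMaxCompletePair

lemma isMinor_top_of_isCompleteBetween [Fintype V] (hT : Gᶜ.CliqueFree 3)
    (hm : 2 * m ≤ Fintype.card V + 1) (hX : X.Nonempty) (hY : Y.Nonempty)
    (hXY : Gᶜ.IsCompleteBetween X Y) (hmXY : m ≤ #X + #Y) :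
    (⊤ : SimpleGraph (Fin m)).IsMinor G := by
  obtain ⟨A, B, h⟩ := exists_isMaxCompletePair hX hY hXY
  have hmAB : m ≤ #A + #B := hmXY.trans (h.card_le X Y hX hY hXY)
  set R := (A ∪ B)ᶜ
  set RA := {s ∈ R | ∀ a ∈ A, ¬ Gᶜ.Adj s a}
  set RB := {s ∈ R | ∀ b ∈ B, ¬ Gᶜ.Adj s b}
  have hcover : R ⊆ RA ∪ RB := by
    intro s hs
    rw [mem_union, mem_filter, mem_filter]
    by_contra! hno
    obtain ⟨a, ha, hsa⟩ := hno.1 hs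
    obtain ⟨b, hb, hsb⟩ := hno.2 hs
    exact not_adj_of_triangleFree hT hsa (h.isCompleteBetween ha hb) hsb
  have hcount : Fintype.card V ≤ #A + #B + (#RA + #RB) := by
    rw [← card_add_card_compl (A ∪ B)]
    exact add_le_add (card_union_le A B) ((card_le_card hcover).trans (card_union_le RA RB))
  have hdisj : Disjoint R (A ∪ B) := disjoint_compl_left
  rw [disjoint_union_right] at hdisj
  by_cases hmA : m ≤ #A + #RA
  · exact h.isMinor_top hT (hdisj.1.mono_left (filter_subset _ _))
      (hdisj.2.mono_left (filter_subset _ _)) (fun s hs => (mem_filter.1 hs).2) hmA hmAB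
  · exact h.symm.isMinor_top hT (S := RB) (hdisj.2.mono_left (filter_subset _ _))
      (hdisj.1.mono_left (filter_subset _ _)) (fun s hs => (mem_filter.1 hs).2) (by omega)
      (by omega)

end CompleteMinors

section RandomPairs

lemma expect_smul_eq {Γ X : Type*} [Group Γ] [Fintype Γ] [Fintype X] [MulAction Γ X]
    [MulAction.IsPretransitive Γ X] (f : X → ℝ) (x : X) :
    𝔼 g : Γ, f (g • x) = 𝔼 z, f z := by
  have : Nonempty X := ⟨x⟩
  have hconst (z : X) : 𝔼 g : Γ, f (g • z) = 𝔼 g : Γ, f (g • x) := by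
    obtain ⟨h, rfl⟩ := MulAction.exists_smul_eq Γ x z
    simp_rw [← mul_smul]
    exact Fintype.expect_equiv (Equiv.mulRight h) _ _ fun g => rfl
  calc 𝔼 g : Γ, f (g • x)
      = 𝔼 z : X, 𝔼 g : Γ, f (g • z) := by simp only [hconst, Fintype.expect_const]
    _ = 𝔼 g : Γ, 𝔼 z : X, f (g • z) := expect_comm _ _ _
    _ = 𝔼 _g : Γ, 𝔼 z : X, f z := expect_congr rfl fun g _ =>
        Fintype.expect_equiv (MulAction.toPerm g) _ _ fun z => rfl
    _ = 𝔼 z, f z := Fintype.expect_const _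

variable {α : Type*} [Fintype α]

lemma expect_perm_smul_embedding {k : ℕ} (f : (Fin k ↪ α) → ℝ) (x : Fin k ↪ α) :
    𝔼 σ : Equiv.Perm α, f (σ • x) = 𝔼 z, f z :=
  have := Equiv.Perm.isMultiplyPretransitive α k
  expect_smul_eq f x

lemma expect_perm_two (f : α → α → ℝ) {a b : α} (hab : a ≠ b) :
    𝔼 σ : Equiv.Perm α, f (σ a) (σ b) = 𝔼 z : Fin 2 ↪ α, f (z 0) (z 1) := by
  have hba := hab.symm
  let x : Fin 2 ↪ α := ⟨![a, b], by intro i j; fin_cases i <;> fin_cases j <;> simp_all⟩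
  exact expect_perm_smul_embedding (fun z : Fin 2 ↪ α => f (z 0) (z 1)) x

lemma expect_perm_four (f : α → α → α → α → ℝ) {x : Fin 4 → α} (hx : x.Injective) :
    𝔼 σ : Equiv.Perm α, f (σ (x 0)) (σ (x 1)) (σ (x 2)) (σ (x 3)) =
      𝔼 z : Fin 4 ↪ α, f (z 0) (z 1) (z 2) (z 3) :=
  expect_perm_smul_embedding (fun z : Fin 4 ↪ α => f (z 0) (z 1) (z 2) (z 3)) ⟨x, hx⟩

/- A uniformly random permutation of a fixed family of disjoint pairs attains the right-hand side
on average. -/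
lemma exists_pairs_le_expect (f : α → α → ℝ) (g : α → α → α → α → ℝ) {P : ℕ}
    (hP : 2 * P ≤ Fintype.card α) :
    ∃ w : Fin P ⊕ Fin P ↪ α,
      ∑ i, f (w (.inl i)) (w (.inr i)) +
        ∑ ij ∈ (univ : Finset (Fin P)).offDiag,
          g (w (.inl ij.1)) (w (.inr ij.1)) (w (.inl ij.2)) (w (.inr ij.2)) ≤
      P * 𝔼 z : Fin 2 ↪ α, f (z 0) (z 1) +
        P * (P - 1) * 𝔼 z : Fin 4 ↪ α, g (z 0) (z 1) (z 2) (z 3) := by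
  obtain ⟨ι⟩ : Nonempty (Fin P ⊕ Fin P ↪ α) :=
    Function.Embedding.nonempty_of_card_le (by simpa [two_mul] using hP)
  have h2 (i : Fin P) : 𝔼 σ : Equiv.Perm α, f (σ (ι (.inl i))) (σ (ι (.inr i))) =
      𝔼 z : Fin 2 ↪ α, f (z 0) (z 1) := expect_perm_two f (ι.injective.ne (by simp))
  have h4 : ∀ ij ∈ (univ : Finset (Fin P)).offDiag, 𝔼 σ : Equiv.Perm α,
      g (σ (ι (.inl ij.1))) (σ (ι (.inr ij.1))) (σ (ι (.inl ij.2))) (σ (ι (.inr ij.2))) =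
      𝔼 z : Fin 4 ↪ α, g (z 0) (z 1) (z 2) (z 3) := by
    rintro ⟨i, j⟩ hij
    have hij : i ≠ j := (mem_offDiag.1 hij).2.2
    have hji := hij.symm
    refine expect_perm_four g (x := ![ι (.inl i), ι (.inr i), ι (.inl j), ι (.inr j)]) ?_
    intro a b hab
    fin_cases a <;> fin_cases b <;> simp_all
  have hexpect : 𝔼 σ : Equiv.Perm α, (∑ i, f (σ (ι (.inl i))) (σ (ι (.inr i))) +
      ∑ ij ∈ (univ : Finset (Fin P)).offDiag,
        g (σ (ι (.inl ij.1))) (σ (ι (.inr ij.1))) (σ (ι (.inl ij.2))) (σ (ι (.inr ij.2)))) =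
      P * 𝔼 z : Fin 2 ↪ α, f (z 0) (z 1) +
        P * (P - 1) * 𝔼 z : Fin 4 ↪ α, g (z 0) (z 1) (z 2) (z 3) := by
    rw [expect_add_distrib, expect_sum_comm, expect_sum_comm, sum_congr rfl fun i _ => h2 i,
      sum_congr rfl h4]
    simp only [sum_const, nsmul_eq_mul, card_univ, Fintype.card_fin, offDiag_card]
    rw [Nat.cast_sub (Nat.le_mul_self P)]
    push_cast
    ring
  obtain ⟨σ, -, hσ⟩ := exists_le_of_expect_le univ_nonempty hexpect.le
  exact ⟨ι.trans σ.toEmbedding, hσ⟩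

lemma expect_embedding_two (h : α → α → ℝ) (h0 : ∀ a, h a a = 0) :
    𝔼 z : Fin 2 ↪ α, h (z 0) (z 1) =
      (∑ a, ∑ b, h a b) / (Fintype.card α * (Fintype.card α - 1)) := by
  have hinj : Function.Injective (fun z : Fin 2 ↪ α => (z 0, z 1)) := by
    intro z z' hz
    ext i
    fin_cases i <;> simp_all
  rw [Fintype.expect_eq_sum_div_card, Fintype.card_embedding_eq, Fintype.card_fin,
    Nat.cast_descFactorial_two, ← Fintype.sum_prod_type' (f := h)]
  congr 1
  rw [← sum_image (g := fun z : Fin 2 ↪ α => (z 0, z 1)) (f := fun p : α × α => h p.1 p.2)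
    hinj.injOn]
  refine sum_subset (subset_univ _) ?_
  rintro ⟨a, b⟩ - hn
  by_cases hab : a = b
  · simp only [hab, h0]
  · refine (hn (mem_image.2 ⟨⟨![a, b], ?_⟩, mem_univ _, rfl⟩)).elim
    intro i j hij
    fin_cases i <;> fin_cases j <;> simp_all

lemma card_embedding_four (h : 3 ≤ Fintype.card α) : (Fintype.card (Fin 4 ↪ α) : ℝ) =
    Fintype.card α * (Fintype.card α - 1) * (Fintype.card α - 2) * (Fintype.card α - 3) := by
  rw [Fintype.card_embedding_eq, Fintype.card_fin]
  simp only [Nat.descFactorial, Nat.sub_zero]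
  push_cast [h, show 2 ≤ Fintype.card α by lia, show 1 ≤ Fintype.card α by lia]
  ring

lemma expect_embedding_four_le (hα : 3 ≤ Fintype.card α) (h : α → α → α → α → ℝ)
    (h0 : ∀ a b c d, 0 ≤ h a b c d) :
    𝔼 z : Fin 4 ↪ α, h (z 0) (z 1) (z 2) (z 3) ≤ (∑ a, ∑ b, ∑ c, ∑ d, h a b c d) /
      (Fintype.card α * (Fintype.card α - 1) * (Fintype.card α - 2) * (Fintype.card α - 3)) := by
  have hinj : Function.Injective (fun z : Fin 4 ↪ α => (z 0, z 1, z 2, z 3)) := by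
    intro z z' hz
    ext i
    fin_cases i <;> simp_all
  rw [Fintype.expect_eq_sum_div_card, ← card_embedding_four hα]
  refine div_le_div_of_nonneg_right ?_ (Nat.cast_nonneg _)
  rw [show ∑ a, ∑ b, ∑ c, ∑ d, h a b c d = ∑ p : α × α × α × α, h p.1 p.2.1 p.2.2.1 p.2.2.2 by
      simp only [Fintype.sum_prod_type],
    ← sum_image (g := fun z : Fin 4 ↪ α => (z 0, z 1, z 2, z 3))
      (f := fun p : α × α × α × α => h p.1 p.2.1 p.2.2.1 p.2.2.2) hinj.injOn]
  exact sum_le_univ_sum_of_nonneg fun p => h0 _ _ _ _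

lemma variance_bound {v g P μ : ℝ} (hv : 6 ≤ v) (hP : 0 ≤ P) (hPv : 2 * P ≤ v)
    (hg : 0 ≤ g) (hg' : g ≤ v * (v - 1)) (hμ : μ = P * (g / (v * (v - 1)))) :
    μ * (1 - 2 * μ) + P * (P - 1) * (g ^ 2 / (v * (v - 1) * (v - 2) * (v - 3))) + μ ^ 2 ≤
      2 * v := by
  have h0 : 0 < v := by linarith
  have h1 : 0 < v - 1 := by linarith
  have h2 : 0 < v - 2 := by linarith
  have h3 : 0 < v - 3 := by linarith
  set r := g / (v * (v - 1)) with hr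
  have hr1 : r ≤ 1 := (div_le_one (by positivity)).2 hg'
  have hμ0 : 0 ≤ μ := by rw [hμ]; positivity
  have hμ1 : μ ≤ v / 2 := by rw [hμ]; nlinarith
  have hmain : P * (P - 1) * (g ^ 2 / (v * (v - 1) * (v - 2) * (v - 3))) ≤
      μ ^ 2 * ((v - 1) / (v - 3)) := by
    calc P * (P - 1) * (g ^ 2 / (v * (v - 1) * (v - 2) * (v - 3)))
        = P * (P - 1) * (r ^ 2 * (v / (v - 2)) * ((v - 1) / (v - 3))) := by
          rw [hr]; field_simp
      _ ≤ P ^ 2 * ((v - 2) / v) * (r ^ 2 * (v / (v - 2)) * ((v - 1) / (v - 3))) := by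
          refine mul_le_mul_of_nonneg_right ?_ (by positivity)
          rw [mul_div_assoc', le_div_iff₀ h0]
          nlinarith [mul_nonneg hP (sub_nonneg.2 hPv)]
      _ = μ ^ 2 * ((v - 1) / (v - 3)) := by rw [hμ]; field_simp
  have hfrac : μ ^ 2 * ((v - 1) / (v - 3)) ≤ μ ^ 2 + v := by
    rw [mul_div_assoc', div_le_iff₀ h3]
    nlinarith [mul_nonneg (sub_nonneg.2 hμ1) hμ0, mul_nonneg h0.le (sub_nonneg.2 hv)]
  nlinarith

lemma natCast_mul_sub_one (n : ℕ) : ((n * (n - 1) : ℕ) : ℝ) = n * (n - 1) := by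
  cases n <;> simp

lemma natCast_mul_sub_one_nonneg (n : ℕ) : (0 : ℝ) ≤ n * (n - 1) := by
  rw [← natCast_mul_sub_one]
  exact Nat.cast_nonneg _

variable {K : SimpleGraph α}

lemma expect_adj_adj_le (hα : 4 ≤ Fintype.card α) :
    𝔼 z : Fin 4 ↪ α, (if K.Adj (z 0) (z 1) ∧ K.Adj (z 2) (z 3) then (1 : ℝ) else 0) ≤
      (∑ a, ∑ b, if K.Adj a b then (1 : ℝ) else 0) ^ 2 /
      (Fintype.card α * (Fintype.card α - 1) * (Fintype.card α - 2) * (Fintype.card α - 3)) := by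
  refine (expect_embedding_four_le (by lia)
    (fun a b c d => if K.Adj a b ∧ K.Adj c d then (1 : ℝ) else 0)
    fun a b c d => by positivity).trans_eq ?_
  have hmul (a b c d : α) : (if K.Adj a b ∧ K.Adj c d then (1 : ℝ) else 0) =
      (if K.Adj a b then 1 else 0) * (if K.Adj c d then 1 else 0) := by
    rw [ite_zero_mul_ite_zero, mul_one]
  simp only [hmul, pow_two, ← Finset.mul_sum, ← Finset.sum_mul]

lemma sum_adj_le : ∑ a, ∑ b, (if K.Adj a b then (1 : ℝ) else 0) ≤
    Fintype.card α * (Fintype.card α - 1) := by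
  rw [← nsmul_eq_mul]
  refine sum_le_card_nsmul _ _ _ fun a _ => ?_
  rw [sum_boole, ← SimpleGraph.neighborFinset_eq_filter, SimpleGraph.card_neighborFinset_eq_degree,
    le_sub_iff_add_le]
  exact_mod_cast K.degree_lt_card_verts a

lemma expect_sq_deviation_le {P : ℕ} (hP : 2 * P ≤ Fintype.card α) (h6 : 6 ≤ Fintype.card α)
    {μ : ℝ} (hμ : μ = P * 𝔼 z : Fin 2 ↪ α, if K.Adj (z 0) (z 1) then (1 : ℝ) else 0) :
    μ * (1 - 2 * μ) + P * (P - 1) *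
      𝔼 z : Fin 4 ↪ α, (if K.Adj (z 0) (z 1) ∧ K.Adj (z 2) (z 3) then (1 : ℝ) else 0) + μ ^ 2 ≤
      2 * Fintype.card α := by
  have hPP := natCast_mul_sub_one_nonneg P
  rw [expect_embedding_two (fun a b => if K.Adj a b then (1 : ℝ) else 0) (by simp)] at hμ
  refine le_trans ?_ (variance_bound (P := P) (by exact_mod_cast h6) (Nat.cast_nonneg _)
    (by exact_mod_cast hP) (by positivity) sum_adj_le hμ)
  gcongr
  exact expect_adj_adj_le (by lia)

/- The concentration term is absorbed into the pair costs, since `#I ^ 2` counts the elements and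
the ordered pairs of distinct elements of `I`. -/
lemma exists_pairs_concentrated (c : α → α → ℝ) (D : α → α → α → α → ℝ) {P : ℕ}
    (hP : 2 * P ≤ Fintype.card α) (h6 : 6 ≤ Fintype.card α) {μ lam : ℝ}
    (hμ : μ = P * 𝔼 z : Fin 2 ↪ α, if K.Adj (z 0) (z 1) then (1 : ℝ) else 0) (hlam : 0 ≤ lam) :
    ∃ (w : Fin P ⊕ Fin P ↪ α) (I : Finset (Fin P)),
      (∀ i, i ∈ I ↔ K.Adj (w (.inl i)) (w (.inr i))) ∧
      ∑ i ∈ I, c (w (.inl i)) (w (.inr i)) +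
          ∑ ij ∈ I.offDiag, D (w (.inl ij.1)) (w (.inr ij.1)) (w (.inl ij.2)) (w (.inr ij.2)) +
          lam * (#I - μ) ^ 2 ≤
        P * 𝔼 z : Fin 2 ↪ α, (if K.Adj (z 0) (z 1) then c (z 0) (z 1) else 0) +
          P * (P - 1) * 𝔼 z : Fin 4 ↪ α, (if K.Adj (z 0) (z 1) ∧ K.Adj (z 2) (z 3)
            then D (z 0) (z 1) (z 2) (z 3) else 0) +
          lam * (2 * Fintype.card α) := by
  obtain ⟨w, hw⟩ := exists_pairs_le_expect
    (fun a b => (if K.Adj a b then c a b else 0) +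
      lam * (1 - 2 * μ) * if K.Adj a b then 1 else 0)
    (fun a b a' b' => (if K.Adj a b ∧ K.Adj a' b' then D a b a' b' else 0) +
      lam * if K.Adj a b ∧ K.Adj a' b' then 1 else 0) hP
  set I := univ.filter fun i => K.Adj (w (.inl i)) (w (.inr i)) with hI
  have hoffDiag : univ.offDiag.filter (fun ij : Fin P × Fin P =>
      K.Adj (w (.inl ij.1)) (w (.inr ij.1)) ∧ K.Adj (w (.inl ij.2)) (w (.inr ij.2))) =
      I.offDiag := by
    grind
  have hcard : (#I.offDiag : ℝ) = (#I : ℝ) ^ 2 - #I := by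
    rw [offDiag_card, Nat.cast_sub (Nat.le_mul_self _), Nat.cast_mul, pow_two]
  refine ⟨w, I, fun i => by simp [hI], ?_⟩
  simp only [sum_add_distrib, expect_add_distrib, ← Finset.mul_sum, ← Finset.mul_expect,
    ← Finset.sum_filter, hoffDiag, ← hI, sum_const, nsmul_one, hcard] at hw
  have hvar := mul_le_mul_of_nonneg_left (expect_sq_deviation_le (K := K) hP h6 hμ) hlam
  have hmean : P * (lam * (1 - 2 * μ) * 𝔼 z : Fin 2 ↪ α, if K.Adj (z 0) (z 1) then (1 : ℝ) else 0) =
      lam * (μ * (1 - 2 * μ)) := by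
    rw [hμ]; ring
  linear_combination hw + hvar + hmean

end RandomPairs

section EdgeCounts

variable {V : Type*} {T : SimpleGraph V} [DecidableRel T.Adj]

lemma card_interedges_eq_sum (A B : Finset V) :
    #(T.interedges A B) = ∑ a ∈ A, #(B.filter (T.Adj a)) := by
  simp only [SimpleGraph.interedges, Rel.interedges, card_filter, sum_product]

lemma sum_sum_adj_eq_card_interedges (A B : Finset V) :
    ∑ a ∈ A, ∑ b ∈ B, (if T.Adj a b then (1 : ℝ) else 0) = #(T.interedges A B) := by
  simp only [card_interedges_eq_sum, sum_boole, Nat.cast_sum]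

variable [Fintype V] {q : ℕ}

lemma card_filter_adj_le (hdeg : ∀ u, T.degree u ≤ q) (u : V) (B : Finset V) :
    #(B.filter (T.Adj u)) ≤ q := by
  refine (card_le_card (filter_subset_filter _ (subset_univ B))).trans ?_
  rw [← SimpleGraph.neighborFinset_eq_filter]
  exact hdeg u

lemma card_interedges_le (hdeg : ∀ u, T.degree u ≤ q) (A B : Finset V) :
    #(T.interedges A B) ≤ #A * q := by
  rw [card_interedges_eq_sum]
  exact sum_le_card_nsmul _ _ q fun a _ => card_filter_adj_le hdeg a B

lemma card_interedges_self_add_le (hdeg : ∀ u, T.degree u ≤ q) {C W : Finset V}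
    (hCW : Disjoint C W) :
    #(T.interedges W W) + #(T.interedges C W) ≤ q * #W := by
  calc #(T.interedges W W) + #(T.interedges C W)
      = #(T.interedges W W) + #(T.interedges W C) := by
        have := T.symm
        exact congrArg _ (Rel.card_interedges_comm C W)
    _ = #(T.interedges W (W ∪ C)) := by
        simp only [card_interedges_eq_sum, ← sum_add_distrib, filter_union]
        exact sum_congr rfl fun a _ =>
          (card_union_of_disjoint (disjoint_filter_filter hCW.symm)).symm
    _ ≤ q * #W := (card_interedges_le hdeg W _).trans_eq (mul_comm _ _)

lemma sum_card_common_nbrs_le (hdeg : ∀ u, T.degree u ≤ q) (C W : Finset V) :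
    ∑ a ∈ W, ∑ b ∈ W, (#{c ∈ C | T.Adj c a ∧ T.Adj c b} : ℝ) ≤ q * #(T.interedges C W) := by
  have hcount : ∑ a ∈ W, ∑ b ∈ W, #{c ∈ C | T.Adj c a ∧ T.Adj c b} =
      ∑ c ∈ C, #(W.filter (T.Adj c)) * #(W.filter (T.Adj c)) := by
    simp only [card_filter, sum_mul_sum, ite_zero_mul_ite_zero, mul_one]
    rw [sum_comm (s := C)]
    exact sum_congr rfl fun a _ => sum_comm
  rw [card_interedges_eq_sum]
  norm_cast
  rw [hcount, Finset.mul_sum]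
  gcongr
  exact card_filter_adj_le hdeg _ W

/- Dropping the condition `T.Adj b b'` leaves walks `b a' a b'`, of which there are at most `q ^ 2`
for each middle edge. -/
lemma sum_adj_four_le (hdeg : ∀ u, T.degree u ≤ q) (W : Finset V) :
    ∑ a ∈ W, ∑ b ∈ W, ∑ a' ∈ W, ∑ b' ∈ W,
      (if T.Adj a a' ∧ T.Adj a b' ∧ T.Adj b a' ∧ T.Adj b b' then (1 : ℝ) else 0) ≤
      q ^ 2 * #(T.interedges W W) := by
  have hd (u : V) : ∑ w ∈ W, (if T.Adj u w then (1 : ℝ) else 0) ≤ q := by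
    rw [sum_boole]
    exact_mod_cast card_filter_adj_le hdeg u W
  calc ∑ a ∈ W, ∑ b ∈ W, ∑ a' ∈ W, ∑ b' ∈ W,
        (if T.Adj a a' ∧ T.Adj a b' ∧ T.Adj b a' ∧ T.Adj b b' then (1 : ℝ) else 0)
      ≤ ∑ a ∈ W, ∑ b ∈ W, ∑ a' ∈ W, ∑ b' ∈ W, (if T.Adj a a' then (1 : ℝ) else 0) *
        ((if T.Adj a' b then 1 else 0) * (if T.Adj a b' then 1 else 0)) := by
        gcongr with a _ b _ a' _ b' _
        simp only [ite_zero_mul_ite_zero, mul_one, T.adj_comm a' b]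
        grind
    _ = ∑ a ∈ W, ∑ a' ∈ W, (if T.Adj a a' then (1 : ℝ) else 0) *
        ((∑ b ∈ W, if T.Adj a' b then 1 else 0) * ∑ b' ∈ W, if T.Adj a b' then 1 else 0) := by
        refine sum_congr rfl fun a _ => ?_
        rw [sum_comm]
        simp only [← Finset.mul_sum, ← Finset.sum_mul]
    _ ≤ ∑ a ∈ W, ∑ a' ∈ W, (if T.Adj a a' then (1 : ℝ) else 0) * ((q : ℝ) * q) := by
        gcongr with a _ a' _
        exacts [hd a', hd a]
    _ = q ^ 2 * #(T.interedges W W) := by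
        simp only [← Finset.sum_mul, sum_sum_adj_eq_card_interedges]
        ring

end EdgeCounts

section RandomMatching

variable {V : Type*} {G : SimpleGraph V} {C W : Finset V} {P : ℕ}

/-- The pairs `{w (inl i), w (inr i)}`, `i ∈ I`, of a list `w` of disjoint pairs of elements
of `W`. -/
noncomputable def pairFamily (w : Fin P ⊕ Fin P ↪ W) (I : Finset (Fin P)) :
    Finset (Finset V) :=
  I.image fun i => {(w (.inl i) : V), (w (.inr i) : V)}

variable {w : Fin P ⊕ Fin P ↪ W} {I : Finset (Fin P)}

lemma disjoint_pair {i j : Fin P} (hij : i ≠ j) :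
    Disjoint ({(w (.inl i) : V), (w (.inr i) : V)} : Finset V)
      {(w (.inl j) : V), (w (.inr j) : V)} := by
  simp [hij.symm]

lemma card_pairFamily : #(pairFamily w I) = #I := by
  refine card_image_of_injective _ fun i j hij => ?_
  by_contra hne
  have h := disjoint_pair (w := w) hne
  rw [show _ = _ from hij, disjoint_self] at h
  exact insert_ne_empty _ _ h

lemma subset_and_card_eq_two_of_mem_pairFamily {S : Finset V} (hS : S ∈ pairFamily w I) :
    S ⊆ W ∧ #S = 2 := by
  obtain ⟨i, -, rfl⟩ := mem_image.1 hS
  refine ⟨?_, card_pair ?_⟩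
  · simp [insert_subset_iff]
  · simp

lemma isBranchFamily_pairFamily (hI : ∀ i ∈ I, G.Adj (w (.inl i)) (w (.inr i))) :
    IsBranchFamily G (pairFamily w I) where
  connected := by
    simp only [pairFamily, forall_mem_image]
    intro i hi
    rw [coe_pair]
    exact SimpleGraph.induce_pair_connected_of_adj (hI i hi)
  pairwiseDisjoint := by
    intro S hS S' hS' hne
    obtain ⟨i, -, rfl⟩ := mem_image.1 hS
    obtain ⟨j, -, rfl⟩ := mem_image.1 hS'
    exact disjoint_pair fun h => hne (h ▸ rfl)

lemma card_interedges_singletons_pairFamily_le (hCW : Disjoint C W) :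
    #((touchGraph G)ᶜ.interedges (C.image fun v => {v}) (pairFamily w I)) ≤
      ∑ i ∈ I, #{c ∈ C | Gᶜ.Adj c (w (.inl i)) ∧ Gᶜ.Adj c (w (.inr i))} := by
  rw [← card_sigma]
  refine card_le_card_of_surjOn
    (fun x : (_ : Fin P) × V => ({x.2}, {(w (.inl x.1) : V), (w (.inr x.1) : V)})) ?_
  rintro ⟨S, S'⟩ h
  obtain ⟨hS, hS', hadj⟩ := (SimpleGraph.mem_interedges_iff _).1 h
  obtain ⟨c, hc, rfl⟩ := mem_image.1 hS
  obtain ⟨i, hi, rfl⟩ := mem_image.1 hS'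
  have hcW : Disjoint {c} ({(w (.inl i) : V), (w (.inr i) : V)} : Finset V) := by
    rw [disjoint_left] at *; grind
  have hcompl := fun v => compl_adj_of_compl_touchGraph_adj hadj hcW (mem_singleton_self c) (v := v)
  refine ⟨⟨i, c⟩, mem_coe.2 (mem_sigma.2 ⟨hi, mem_filter.2 ⟨hc, ?_⟩⟩), rfl⟩
  exact ⟨hcompl _ (mem_insert_self ..), hcompl _ (by simp)⟩

lemma card_interedges_pairFamily_self_le :
    #((touchGraph G)ᶜ.interedges (pairFamily w I) (pairFamily w I)) ≤
      #{ij ∈ I.offDiag | Gᶜ.Adj (w (.inl ij.1)) (w (.inl ij.2)) ∧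
        Gᶜ.Adj (w (.inl ij.1)) (w (.inr ij.2)) ∧ Gᶜ.Adj (w (.inr ij.1)) (w (.inl ij.2)) ∧
        Gᶜ.Adj (w (.inr ij.1)) (w (.inr ij.2))} := by
  refine card_le_card_of_surjOn (fun ij : Fin P × Fin P =>
    ({(w (.inl ij.1) : V), (w (.inr ij.1) : V)}, {(w (.inl ij.2) : V), (w (.inr ij.2) : V)})) ?_
  rintro ⟨S, S'⟩ h
  obtain ⟨hS, hS', hadj⟩ := (SimpleGraph.mem_interedges_iff _).1 h
  obtain ⟨i, hi, rfl⟩ := mem_image.1 hS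
  obtain ⟨j, hj, rfl⟩ := mem_image.1 hS'
  have hij : i ≠ j := by rintro rfl; exact hadj.ne rfl
  have hcompl := fun u v => compl_adj_of_compl_touchGraph_adj hadj (disjoint_pair hij)
    (u := u) (v := v)
  refine ⟨(i, j), mem_coe.2 (mem_filter.2 ⟨mem_offDiag.2 ⟨hi, hj, hij⟩, ?_⟩), rfl⟩
  refine ⟨hcompl _ _ ?_ ?_, hcompl _ _ ?_ ?_, hcompl _ _ ?_ ?_, hcompl _ _ ?_ ?_⟩ <;> simp

lemma sum_sum_adj_eq (W : Finset V) :
    ∑ a ∈ W, ∑ b ∈ W, (if G.Adj a b then (1 : ℝ) else 0) =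
      #W * (#W - 1) - #(Gᶜ.interedges W W) := by
  rw [← sum_sum_adj_eq_card_interedges, eq_sub_iff_add_eq, ← sum_add_distrib, ← nsmul_eq_mul]
  refine sum_eq_card_nsmul fun a ha => ?_
  rw [← sum_add_distrib, ← sum_erase_add _ _ ha]
  have hone : ∀ b ∈ W.erase a, (if G.Adj a b then (1 : ℝ) else 0) +
      (if Gᶜ.Adj a b then 1 else 0) = 1 := by
    intro b hb
    have hab : a ≠ b := (ne_of_mem_erase hb).symm
    by_cases h : G.Adj a b <;> simp [SimpleGraph.compl_adj, h, hab]
  rw [sum_congr rfl hone]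
  simp [card_erase_of_mem ha, Nat.cast_sub (card_pos.2 ⟨a, ha⟩)]

lemma expect_adj_eq (W : Finset V) :
    𝔼 z : Fin 2 ↪ W, (if G.Adj (z 0) (z 1) then (1 : ℝ) else 0) =
      (#W * (#W - 1) - #(Gᶜ.interedges W W)) / (#W * (#W - 1)) := by
  rw [expect_embedding_two (fun a b : W => if G.Adj a b then (1 : ℝ) else 0) (by simp),
    Fintype.card_coe, ← sum_sum_adj_eq]
  simp_rw [← Finset.sum_coe_sort W]

variable [Fintype V] {q : ℕ}

lemma expect_card_common_nbrs_le (hdeg : ∀ u, Gᶜ.degree u ≤ q) (C W : Finset V) :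
    𝔼 z : Fin 2 ↪ W, (if G.Adj (z 0) (z 1) then
      2 * (#{c ∈ C | Gᶜ.Adj c (z 0) ∧ Gᶜ.Adj c (z 1)} : ℝ) else 0) ≤
      2 * (q * #(Gᶜ.interedges C W)) / (#W * (#W - 1)) := by
  rw [expect_embedding_two (fun a b : W => if G.Adj a b then
    2 * (#{c ∈ C | Gᶜ.Adj c a ∧ Gᶜ.Adj c b} : ℝ) else 0) (by simp), Fintype.card_coe]
  refine div_le_div_of_nonneg_right ?_ (natCast_mul_sub_one_nonneg _)
  refine le_trans ?_ (mul_le_mul_of_nonneg_left (sum_card_common_nbrs_le hdeg C W) zero_le_two)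
  simp_rw [← Finset.sum_coe_sort W, Finset.mul_sum]
  gcongr
  split_ifs <;> simp

lemma expect_adj_four_le (hdeg : ∀ u, Gᶜ.degree u ≤ q) {W : Finset V} (hW : 3 ≤ #W) :
    𝔼 z : Fin 4 ↪ W, (if G.Adj (z 0) (z 1) ∧ G.Adj (z 2) (z 3) then
      (if Gᶜ.Adj (z 0) (z 2) ∧ Gᶜ.Adj (z 0) (z 3) ∧ Gᶜ.Adj (z 1) (z 2) ∧ Gᶜ.Adj (z 1) (z 3)
        then (1 : ℝ) else 0) else 0) ≤
      q ^ 2 * #(Gᶜ.interedges W W) / (#W * (#W - 1) * (#W - 2) * (#W - 3)) := by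
  have h3 : (3 : ℝ) ≤ #W := by exact_mod_cast hW
  have hpos : 0 ≤ (#W : ℝ) * (#W - 1) * (#W - 2) * (#W - 3) := by
    have : (0 : ℝ) ≤ #W - 1 := by linarith
    have : (0 : ℝ) ≤ #W - 2 := by linarith
    have : (0 : ℝ) ≤ #W - 3 := by linarith
    positivity
  refine le_trans ?_ (div_le_div_of_nonneg_right (sum_adj_four_le hdeg W) hpos)
  simp_rw [← Finset.sum_coe_sort W]
  rw [← Fintype.card_coe W]
  refine le_trans ?_ (expect_embedding_four_le (by simpa using hW) (fun a b a' b' : W =>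
    if Gᶜ.Adj a.1 a' ∧ Gᶜ.Adj a.1 b' ∧ Gᶜ.Adj b.1 a' ∧ Gᶜ.Adj b.1 b' then (1 : ℝ) else 0)
    fun a b a' b' => by positivity)
  gcongr
  split_ifs <;> simp

lemma exists_concentrated_matching (hdeg : ∀ u, Gᶜ.degree u ≤ q) (hCW : Disjoint C W) (h6 : 6 ≤ #W)
    (hP : 2 * P ≤ #W) {v μ lam : ℝ} (hv : v = #W)
    (hμ : μ = P * ((v * (v - 1) - #(Gᶜ.interedges W W)) / (v * (v - 1)))) (hlam : 0 ≤ lam) :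
    ∃ M : Finset (Finset V), IsBranchFamily G M ∧ (∀ S ∈ M, S ⊆ W ∧ #S = 2) ∧
      2 * (#((touchGraph G)ᶜ.interedges (C.image fun v => {v}) M) : ℝ) +
          #((touchGraph G)ᶜ.interedges M M) + lam * (#M - μ) ^ 2 ≤
        P * (2 * (q * #(Gᶜ.interedges C W)) / (v * (v - 1))) +
          P * (P - 1) * (q ^ 2 * #(Gᶜ.interedges W W) / (v * (v - 1) * (v - 2) * (v - 3))) +
          lam * (2 * v) := by
  have hPP := natCast_mul_sub_one_nonneg P
  subst hv
  rw [← expect_adj_eq] at hμ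
  obtain ⟨w, I, hI, h⟩ := exists_pairs_concentrated (K := G.comap (Subtype.val : W → V))
    (fun a b => 2 * (#{c ∈ C | Gᶜ.Adj c a ∧ Gᶜ.Adj c b} : ℝ))
    (fun a b a' b' => if Gᶜ.Adj a.1 a' ∧ Gᶜ.Adj a.1 b' ∧ Gᶜ.Adj b.1 a' ∧ Gᶜ.Adj b.1 b'
      then (1 : ℝ) else 0) (by simpa using hP) (by simpa using h6) hμ hlam
  refine ⟨pairFamily w I, isBranchFamily_pairFamily fun i hi => (hI i).1 hi,
    fun S hS => subset_and_card_eq_two_of_mem_pairFamily hS, ?_⟩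
  have hCM : 2 * (#((touchGraph G)ᶜ.interedges (C.image fun v => {v}) (pairFamily w I)) : ℝ) ≤
      ∑ i ∈ I, 2 * (#{c ∈ C | Gᶜ.Adj c (w (.inl i)) ∧ Gᶜ.Adj c (w (.inr i))} : ℝ) := by
    rw [← Finset.mul_sum]
    exact_mod_cast Nat.mul_le_mul_left 2 (card_interedges_singletons_pairFamily_le hCW)
  have hMM := Nat.cast_le (α := ℝ).2 (card_interedges_pairFamily_self_le (G := G) (w := w) (I := I))
  rw [← sum_boole] at hMM
  rw [card_pairFamily]
  refine (add_le_add_left (add_le_add hCM hMM) _).trans (h.trans ?_)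
  rw [Fintype.card_coe]
  gcongr
  · exact expect_card_common_nbrs_le hdeg C W
  · exact expect_adj_four_le hdeg (by lia)

end RandomMatching

section Construction

variable {V α : Type*} {G : SimpleGraph V} {C S S' : Finset V} {F M : Finset (Finset V)} {m : ℕ}

lemma interedges_eq_empty {K : SimpleGraph α} [DecidableRel K.Adj] {A B : Finset α}
    (h : ∀ a ∈ A, ∀ b ∈ B, ¬ K.Adj a b) : K.interedges A B = ∅ :=
  filter_false_of_mem fun p hp => h p.1 (mem_product.1 hp).1 p.2 (mem_product.1 hp).2

lemma card_interedges_union_self_le (K : SimpleGraph α) [DecidableRel K.Adj] [DecidableEq α]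
    (A B : Finset α) :
    #(K.interedges (A ∪ B) (A ∪ B)) ≤
      #(K.interedges A A) + 2 * #(K.interedges A B) + #(K.interedges B B) := by
  have hsub : K.interedges (A ∪ B) (A ∪ B) ⊆
      (K.interedges A A ∪ K.interedges A B) ∪ (K.interedges B A ∪ K.interedges B B) := by
    intro p hp
    simp only [mem_union, SimpleGraph.mem_interedges_iff] at hp ⊢
    tauto
  have := K.symm
  have hcomm : #(K.interedges B A) = #(K.interedges A B) := Rel.card_interedges_comm B A
  have hcard := (card_le_card hsub).trans ((card_union_le _ _).trans
    (Nat.add_le_add (card_union_le _ _) (card_union_le _ _)))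
  omega

lemma leftover_singletons [Fintype V] : leftover univ (C.image fun v => {v}) = Cᶜ := by
  ext v
  simp [mem_leftover]

lemma isBranchFamily_of_packing [Fintype V] (hM : IsBranchFamily G M) (hMC : ∀ S ∈ M, S ⊆ Cᶜ)
    (hF : IsGullPacking Gᶜ (leftover Cᶜ M) F) :
    IsBranchFamily G ((C.image fun v => {v}) ∪ M ∪ F) := by
  have hCd : ∀ S ∈ C.image fun v => ({v} : Finset V), ∀ S' ⊆ Cᶜ, Disjoint S S' := by
    rw [forall_mem_image]
    intro v hv S' hS'
    exact disjoint_singleton_left.2 fun h => mem_compl.1 (hS' h) hv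
  refine ((isBranchFamily_singletons C).union hM fun S hS S' hS' => hCd S hS S' (hMC S' hS')).union
    hF.isBranchFamily fun S hS S' hS' => ?_
  obtain hS | hS := mem_union.1 hS
  · exact hCd S hS S' ((hF.subset S' hS').trans leftover_subset)
  · exact (disjoint_of_subset_leftover (hF.subset S' hS') hS).symm

lemma card_packing [Fintype V] (hMC : ∀ S ∈ M, S ⊆ Cᶜ)
    (hF : IsGullPacking Gᶜ (leftover Cᶜ M) F) :
    #((C.image fun v => {v}) ∪ M ∪ F) = #C + #M + #F := by
  have hCM : Disjoint (C.image fun v => ({v} : Finset V)) M := by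
    rw [disjoint_left, forall_mem_image]
    exact fun v hv hvM => mem_compl.1 (hMC _ hvM (mem_singleton_self v)) hv
  have hCMF : Disjoint ((C.image fun v => ({v} : Finset V)) ∪ M) F := by
    refine disjoint_union_left.2 ⟨?_, ?_⟩
    · rw [disjoint_left, forall_mem_image]
      exact fun v hv hvF =>
        mem_compl.1 (leftover_subset (hF.subset _ hvF (mem_singleton_self v))) hv
    · exact disjoint_right.2 fun S hS =>
        notMem_of_subset_leftover (hF.isGull S hS).nonempty (hF.subset S hS)
  rw [card_union_of_disjoint hCMF, card_union_of_disjoint hCM,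
    card_image_of_injective _ singleton_injective]

lemma card_leftover_packing [Fintype V] (hM : IsBranchFamily G M)
    (hMC : ∀ S ∈ M, S ⊆ Cᶜ ∧ #S = 2) (hF : IsGullPacking Gᶜ (leftover Cᶜ M) F) :
    #(leftover univ ((C.image fun v => {v}) ∪ M ∪ F)) + 3 * #F + 2 * #M + #C = Fintype.card V := by
  rw [leftover_union, leftover_union, leftover_singletons, hF.card_leftover_add,
    card_leftover_add_mul_card hM.pairwiseDisjoint (fun S hS => (hMC S hS).1)
      fun S hS => (hMC S hS).2, card_compl_add_card]

lemma IsGull.not_compl_touchGraph_adj (hT : Gᶜ.CliqueFree 3) (h : IsGull Gᶜ S)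
    (hd : Disjoint S S') (hS' : S'.Nonempty) : ¬ (touchGraph G)ᶜ.Adj S S' := by
  obtain ⟨v, hv⟩ := hS'
  obtain ⟨u, hu, huv⟩ := h.exists_adj hT hd hv
  exact fun hadj => (compl_adj_of_compl_touchGraph_adj hadj hd hu hv).2 huv

lemma interedges_compl_touchGraph_singletons (hC : G.IsClique C) :
    (touchGraph G)ᶜ.interedges (C.image fun v => {v}) (C.image fun v => {v}) = ∅ := by
  refine interedges_eq_empty ?_
  simp only [forall_mem_image]
  intro u hu v hv h
  have hne : u ≠ v := fun huv => h.1 (congrArg _ huv)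
  exact h.2 ⟨h.1, u, mem_singleton_self u, v, mem_singleton_self v, hC hu hv hne⟩

lemma card_interedges_packing_le [Fintype V] (hT : Gᶜ.CliqueFree 3) (hC : G.IsClique C)
    (hM : IsBranchFamily G M) (hMC : ∀ S ∈ M, S ⊆ Cᶜ)
    (hF : IsGullPacking Gᶜ (leftover Cᶜ M) F) :
    #((touchGraph G)ᶜ.interedges ((C.image fun v => {v}) ∪ M ∪ F)
        ((C.image fun v => {v}) ∪ M ∪ F)) ≤
      2 * #((touchGraph G)ᶜ.interedges (C.image fun v => {v}) M) +
        #((touchGraph G)ᶜ.interedges M M) := by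
  have hB := isBranchFamily_of_packing hM hMC hF
  have hgull : ∀ B ⊆ (C.image fun v => {v}) ∪ M ∪ F, (touchGraph G)ᶜ.interedges B F = ∅ := by
    refine fun B hBsub => interedges_eq_empty fun S hS S' hS' h => ?_
    have hdisj := hB.pairwiseDisjoint (mem_union_right _ hS') (hBsub hS) h.ne.symm
    exact (hF.isGull S' hS').not_compl_touchGraph_adj hT hdisj (hB.nonempty (hBsub hS)) h.symm
  have hsplit := card_interedges_union_self_le (touchGraph G)ᶜ ((C.image fun v => {v}) ∪ M) F
  rw [hgull _ subset_union_left, hgull _ subset_union_right, card_empty] at hsplit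
  have hsplit' := card_interedges_union_self_le (touchGraph G)ᶜ (C.image fun v => {v}) M
  rw [interedges_compl_touchGraph_singletons hC, card_empty] at hsplit'
  omega

lemma exists_minor_of_packing [Fintype V] (hT : Gᶜ.CliqueFree 3) (hC : G.IsClique C)
    (hM : IsBranchFamily G M) (hMC : ∀ S ∈ M, S ⊆ Cᶜ ∧ #S = 2)
    (hF : IsGullPacking Gᶜ (leftover Cᶜ M) F) (hm : m + #M + 2 * #F ≤ Fintype.card V) :
    ∃ H : SimpleGraph (Fin m), H.IsMinor G ∧
      m * (m - 1) ≤ 2 * H.edgeSet.ncard +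
        (2 * #((touchGraph G)ᶜ.interedges (C.image fun v => {v}) M) +
          #((touchGraph G)ᶜ.interedges M M)) +
        2 * (m * (m - (#C + #M + #F))) := by
  have hMC' : ∀ S ∈ M, S ⊆ Cᶜ := fun S hS => (hMC S hS).1
  have hcard := card_packing hMC' hF
  have hleft := card_leftover_packing hM hMC hF
  obtain ⟨H, hH, hedges⟩ :=
    (isBranchFamily_of_packing hM hMC' hF).exists_isMinor (m := m) (by omega)
  rw [hcard] at hedges
  have hmissing := card_interedges_packing_le hT hC hM hMC' hF
  exact ⟨H, hH, by omega⟩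

lemma degree_compl_le_card [Fintype V] (hT : Gᶜ.CliqueFree 3) (hC : G.IsMaximumClique C) (u : V) :
    Gᶜ.degree u ≤ #C := by
  have hind := Gᶜ.isIndepSet_neighborSet_of_triangleFree hT u
  rw [SimpleGraph.isIndepSet_compl, ← SimpleGraph.coe_neighborFinset] at hind
  exact hC.maximum _ hind

lemma exists_gullPacking_of_large_clique [Fintype V] (hT : Gᶜ.CliqueFree 3)
    (hC : G.IsMaximumClique C) (h4 : Fintype.card V ≤ 4 * #C)
    (hm : 2 * m ≤ Fintype.card V + 1) (hbic : ∀ X Y : Finset V, X.Nonempty → Y.Nonempty →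
      Gᶜ.IsCompleteBetween X Y → #X + #Y < m) :
    ∃ F, IsGullPacking Gᶜ Cᶜ F ∧ #F ≤ Fintype.card V / 2 - #C ∧
      Fintype.card V / 2 - #C ≤ #F + 40 := by
  have hL := card_compl_add_card C
  refine exists_isGullPacking hT (by omega) (fun I hIL hI => ?_) fun X hX Y hY hXn hYn hXY => ?_
  · have hI' := hC.maximum I (SimpleGraph.isIndepSet_compl _ |>.1 hI)
    have hIL' := card_le_card hIL
    omega
  · have hlt := hbic X Y hXn hYn hXY
    have hunion := card_le_card (union_subset hX hY)
    rw [card_union_of_disjoint (disjoint_coe.1 hXY.disjoint)] at hunion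
    omega

lemma exists_minor_of_large_clique [Fintype V] (hT : Gᶜ.CliqueFree 3) (hC : G.IsMaximumClique C)
    (h4 : Fintype.card V ≤ 4 * #C) (hm : Fintype.card V ≤ 2 * m)
    (hm' : 2 * m ≤ Fintype.card V + 1) :
    ∃ H : SimpleGraph (Fin m), H.IsMinor G ∧ m * (m - 1) ≤ 2 * H.edgeSet.ncard + 82 * m := by
  by_cases hbic : ∀ X Y : Finset V, X.Nonempty → Y.Nonempty →
    Gᶜ.IsCompleteBetween X Y → #X + #Y < m
  · obtain ⟨F, hF, hFk, hkF⟩ := exists_gullPacking_of_large_clique hT hC h4 hm' hbic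
    obtain ⟨H, hH, hedges⟩ := exists_minor_of_packing (m := m) hT hC.isClique (M := ∅)
      ⟨by simp, by simp⟩ (by simp) (by simpa only [leftover, biUnion_empty, sdiff_empty] using hF)
      (by rw [card_empty]; omega)
    refine ⟨H, hH, hedges.trans ?_⟩
    have hunused : m * (m - (#C + #F)) ≤ m * 41 := Nat.mul_le_mul_left m (by omega)
    simp only [interedges_eq_empty, card_empty, notMem_empty, false_imp_iff, implies_true,
      mul_zero, add_zero]
    omega
  · push Not at hbic
    obtain ⟨X, Y, hX, hY, hXY, hcard⟩ := hbic
    refine ⟨⊤, isMinor_top_of_isCompleteBetween hT hm' hX hY hXY hcard, ?_⟩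
    rw [← SimpleGraph.coe_edgeFinset, Set.ncard_coe_finset,
      SimpleGraph.card_edgeFinset_top_eq_card_choose_two, Fintype.card_fin, Nat.choose_two_right]
    have := Nat.div_mul_cancel (Nat.even_mul_pred_self m).two_dvd
    omega

end Construction

section CostEstimate

/- Here `n` is the number of vertices, `q` the size of the clique, `v` that of its complement, `x`
and `e` count the non-adjacent pairs from the clique to the complement and, in both orders, within
the complement, `P` is the number of random pairs, and `t` the number of edges wanted. -/
variable {n q v x e t P δ : ℝ}

lemma cost_mono {d s y : ℝ} (hd : 0 < d) (hs : 0 ≤ s) (ht : 0 ≤ t) (hq : 0 ≤ q) (hx : 0 ≤ x)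
    (hxy : x ≤ y) (h : t * q * (s + d) ≤ d ^ 2) :
    2 * t * q * x / (d + x) + t ^ 2 * q ^ 2 * (s - x) / (d + x) ^ 2 ≤
      2 * t * q * y / (d + y) + t ^ 2 * q ^ 2 * (s - y) / (d + y) ^ 2 := by
  have hdx : 0 < d + x := by linarith
  have hdy : 0 < d + y := by linarith
  have hinv : 1 / (d + y) ≤ 1 / (d + x) := one_div_le_one_div_of_le hdx (by linarith)
  have hinv' : 1 / (d + x) ≤ 1 / d := one_div_le_one_div_of_le hd (by linarith)
  have hdiff : 2 * t * q * y / (d + y) + t ^ 2 * q ^ 2 * (s - y) / (d + y) ^ 2 -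
      (2 * t * q * x / (d + x) + t ^ 2 * q ^ 2 * (s - x) / (d + x) ^ 2) =
      t * q * (1 / (d + x) - 1 / (d + y)) *
        (2 * d + t * q - t * q * (s + d) * (1 / (d + x) + 1 / (d + y))) := by
    field_simp
    ring
  have htq : 0 ≤ t * q := mul_nonneg ht hq
  have hfactor : t * q * (s + d) * (1 / (d + x) + 1 / (d + y)) ≤ 2 * d :=
    calc t * q * (s + d) * (1 / (d + x) + 1 / (d + y))
        ≤ t * q * (s + d) * (1 / d + 1 / d) :=
          mul_le_mul_of_nonneg_left (by linarith) (by positivity)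
      _ = 2 * (t * q * (s + d)) / d := by ring
      _ ≤ 2 * d := by
          rw [div_le_iff₀ hd]
          linarith
  rw [← sub_nonneg, hdiff]
  exact mul_nonneg (mul_nonneg htq (by linarith)) (by linarith)

lemma cost_at_sq_eq_missingDensity (hn : 0 < n) (hv : v = n - q) (ht : t = (n - 4 * q) / 2)
    (hg : 0 < v * (v - q) + q ^ 2) :
    2 * t * q * q ^ 2 / (v * (v - q) + q ^ 2) +
      t ^ 2 * q ^ 2 * (q * v - q ^ 2) / (v * (v - q) + q ^ 2) ^ 2 =
      missingDensity (q / n) * n ^ 2 / 4 := by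
  subst hv ht
  have hden : 1 - 3 * (q / n) + 3 * (q / n) ^ 2 = ((n - q) * (n - q - q) + q ^ 2) / n ^ 2 := by
    field_simp
    ring
  rw [missingDensity, hden]
  have hne := hg.ne'
  set d := (n - q) * (n - q - q) + q ^ 2 with hd
  field_simp
  rw [hd]
  ring

lemma cost_le_missingDensity (hn : 0 < n) (hq : 0 ≤ q) (hqn : 4 * q ≤ n) (hv : v = n - q)
    (hx : 0 ≤ x) (hxq : x ≤ q ^ 2) (ht : t = (n - 4 * q) / 2) :
    2 * t * q * x / (v * (v - q) + x) + t ^ 2 * q ^ 2 * (q * v - x) / (v * (v - q) + x) ^ 2 ≤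
      missingDensity (q / n) * n ^ 2 / 4 := by
  have hvq : n / 2 ≤ v - q := by linarith
  have hv0 : 0 < v := by linarith
  have hd0 : 0 < v * (v - q) := mul_pos hv0 (by linarith)
  have ht0 : 0 ≤ t := by linarith
  have htq : t * q ≤ (v - q) ^ 2 :=
    calc t * q ≤ n / 2 * (n / 4) := mul_le_mul (by linarith) (by linarith) hq (by linarith)
      _ ≤ (n / 2) ^ 2 := by nlinarith
      _ ≤ (v - q) ^ 2 := by gcongr
  rw [← cost_at_sq_eq_missingDensity hn hv ht (by positivity)]
  refine cost_mono hd0 (by positivity) ht0 hq hx hxq ?_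
  calc t * q * (q * v + v * (v - q)) = t * q * v ^ 2 := by ring
    _ ≤ (v - q) ^ 2 * v ^ 2 := by gcongr
    _ = (v * (v - q)) ^ 2 := by ring

lemma one_add_mul_sq_mul_le {y : ℝ} (h0 : 0 ≤ y) (h : y ≤ 1 / 8) :
    (1 + 4 * y) ^ 2 * (1 + 8 * y) ≤ 1 + 28 * y := by
  have hsq : y ^ 2 ≤ 1 / 8 * y := by nlinarith
  have hcube : y ^ 3 ≤ 1 / 64 * y := by nlinarith
  linarith [show (1 + 4 * y) ^ 2 * (1 + 8 * y) = 1 + 16 * y + 80 * y ^ 2 + 128 * y ^ 3 by ring]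

lemma div_le_mul_of_mul_sub_le {D : ℝ} (hn : 0 < n) (hD : n ^ 2 / 4 ≤ D - n) (hDe : D - n ≤ v - e)
    (hv : 0 < v) (ht : 0 ≤ t) (hP : P * (v - e) ≤ t * v) : P / v ≤ t * ((1 + 4 / n) / D) := by
  have hg : 0 < v - e := lt_of_lt_of_le (by positivity) (hD.trans hDe)
  have hD0 : 0 < D := by nlinarith
  have hrest : n ≤ 4 / n * (v - e) := by
    rw [div_mul_eq_mul_div, le_div_iff₀ hn]
    linarith
  calc P / v ≤ t / (v - e) := by
        rw [div_le_div_iff₀ hv hg]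
        exact hP
    _ ≤ t * ((1 + 4 / n) / D) := by
        rw [div_eq_mul_one_div]
        refine mul_le_mul_of_nonneg_left ?_ ht
        rw [div_le_div_iff₀ hg hD0]
        linarith

lemma mul_sub_one_mul_div_le {a : ℝ} (ha : 0 ≤ a) (hn : 0 < n) (hv : 3 < v)
    (hvn : n + 12 ≤ 4 * v) (hP : 0 ≤ P) (hPv : 2 * P ≤ v) :
    P * (P - 1) * (a / (v * (v - 1) * (v - 2) * (v - 3))) ≤
      a * (P / (v * (v - 1))) ^ 2 * (1 + 8 / n) := by
  have hv1 : 0 < v - 1 := by linarith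
  have hv2 : 0 < v - 2 := by linarith
  have hv3 : 0 < v - 3 := by linarith
  have hpair : P * (P - 1) ≤ P ^ 2 * ((v - 2) / v) := by
    rw [mul_div_assoc', le_div_iff₀ (by linarith)]
    nlinarith [mul_nonneg hP (sub_nonneg.2 hPv)]
  have hratio : (v - 1) / (v - 3) ≤ 1 + 8 / n := by
    rw [div_le_iff₀ hv3]
    have htwo : 2 ≤ 8 / n * (v - 3) := by
      rw [div_mul_eq_mul_div, le_div_iff₀ hn]
      linarith
    linarith
  calc P * (P - 1) * (a / (v * (v - 1) * (v - 2) * (v - 3)))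
      ≤ P ^ 2 * ((v - 2) / v) * (a / (v * (v - 1) * (v - 2) * (v - 3))) :=
        mul_le_mul_of_nonneg_right hpair (by positivity)
    _ = a * (P / (v * (v - 1))) ^ 2 * ((v - 1) / (v - 3)) := by field_simp
    _ ≤ a * (P / (v * (v - 1))) ^ 2 * (1 + 8 / n) := by gcongr

lemma add_corrections_le {a b : ℝ} (hn : 8 ≤ n) (ha : 0 ≤ a) (hb : 0 ≤ b)
    (hab : a + b ≤ δ * n ^ 2 / 4) (hδ : δ ≤ 1) :
    a * (1 + 4 / n) + b * ((1 + 4 / n) ^ 2 * (1 + 8 / n)) ≤ δ * n ^ 2 / 4 + 7 * n := by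
  have : 0 < n := by linarith
  have hfactor : (1 + 4 / n) ^ 2 * (1 + 8 / n) ≤ 1 + 28 / n := by
    simpa only [mul_one_div] using
      one_add_mul_sq_mul_le (y := 1 / n) (by positivity)
        (one_div_le_one_div_of_le (by norm_num) hn)
  have hn2 : δ * n ^ 2 ≤ 1 * n ^ 2 := by gcongr
  calc a * (1 + 4 / n) + b * ((1 + 4 / n) ^ 2 * (1 + 8 / n))
      ≤ a * (1 + 28 / n) + b * (1 + 28 / n) := by gcongr; norm_num
    _ = (a + b) + (a + b) * 28 / n := by ring
    _ ≤ δ * n ^ 2 / 4 + n ^ 2 / 4 * 28 / n := by gcongr; linarith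
    _ = δ * n ^ 2 / 4 + 7 * n := by field_simp; ring

lemma expected_cost_le (hn : 8 ≤ n) (hq : 0 ≤ q) (hqn : 4 * q ≤ n) (hv : v = n - q) (hx : 0 ≤ x)
    (hxq : x ≤ q ^ 2) (he : 0 ≤ e) (hex : e ≤ q * v - x) (ht : t = (n - 4 * q) / 2) (hP : 0 ≤ P)
    (hPv : 2 * P ≤ v) (hPt : P * (v * (v - 1) - e) ≤ t * (v * (v - 1)))
    (hδ : missingDensity (q / n) ≤ δ) (hδ1 : δ ≤ 1) :
    P * (2 * (q * x) / (v * (v - 1))) +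
      P * (P - 1) * (q ^ 2 * e / (v * (v - 1) * (v - 2) * (v - 3))) ≤ δ * n ^ 2 / 4 + 7 * n := by
  have hn0 : 0 < n := by linarith
  have hv0 : 0 < v := by linarith
  have ht0 : 0 ≤ t := by linarith
  have hs : 0 ≤ q * v - x := he.trans hex
  set D := v * (v - q) + x
  have hDn : n ^ 2 / 4 ≤ D - n := by
    have hvq : 3 / 4 * n * (n / 2) ≤ v * (v - q) :=
      mul_le_mul (by linarith) (by linarith) (by linarith) hv0.le
    nlinarith
  have hD0 : 0 < D := by nlinarith
  have hp : P / (v * (v - 1)) ≤ t * ((1 + 4 / n) / D) :=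
    div_le_mul_of_mul_sub_le hn0 hDn (by linarith) (mul_pos hv0 (by linarith)) ht0 hPt
  have hp0 : 0 ≤ P / (v * (v - 1)) := div_nonneg hP (mul_nonneg hv0.le (by linarith))
  have hfirst : P * (2 * (q * x) / (v * (v - 1))) ≤ 2 * t * q * x / D * (1 + 4 / n) :=
    calc P * (2 * (q * x) / (v * (v - 1))) = 2 * q * x * (P / (v * (v - 1))) := by ring
      _ ≤ 2 * q * x * (t * ((1 + 4 / n) / D)) := by gcongr
      _ = 2 * t * q * x / D * (1 + 4 / n) := by ring
  have hsecond : P * (P - 1) * (q ^ 2 * e / (v * (v - 1) * (v - 2) * (v - 3))) ≤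
      t ^ 2 * q ^ 2 * (q * v - x) / D ^ 2 * ((1 + 4 / n) ^ 2 * (1 + 8 / n)) :=
    calc P * (P - 1) * (q ^ 2 * e / (v * (v - 1) * (v - 2) * (v - 3)))
        ≤ q ^ 2 * e * (P / (v * (v - 1))) ^ 2 * (1 + 8 / n) :=
          mul_sub_one_mul_div_le (by positivity) hn0 (by linarith) (by linarith) hP hPv
      _ ≤ q ^ 2 * (q * v - x) * (t * ((1 + 4 / n) / D)) ^ 2 * (1 + 8 / n) := by gcongr
      _ = t ^ 2 * q ^ 2 * (q * v - x) / D ^ 2 * ((1 + 4 / n) ^ 2 * (1 + 8 / n)) := by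
          rw [mul_pow, div_pow]
          ring
  have hmain : 2 * t * q * x / D + t ^ 2 * q ^ 2 * (q * v - x) / D ^ 2 ≤ δ * n ^ 2 / 4 :=
    (cost_le_missingDensity hn0 hq hqn hv hx hxq ht).trans (by gcongr)
  exact (add_le_add hfirst hsecond).trans
    (add_corrections_le hn (by positivity) (by positivity) hmain hδ1)

end CostEstimate

section SmallClique

variable {V : Type*} {G : SimpleGraph V} {C : Finset V} {n w δ : ℝ} {m : ℕ}

lemma exists_number_of_pairs {q v e t : ℝ} (hn : 8 ≤ n) (hq : 0 ≤ q) (hqn : 4 * q ≤ n)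
    (hv : v = n - q) (he : 0 ≤ e) (hev : e ≤ q * v) (ht : t = (n - 4 * q) / 2) :
    ∃ P : ℕ, 2 * P ≤ v ∧ P * (v * (v - 1) - e) ≤ t * (v * (v - 1)) ∧
      t - 1 ≤ P * ((v * (v - 1) - e) / (v * (v - 1))) := by
  have : 6 ≤ v := by linarith
  have ht0 : 0 ≤ t := by linarith
  have hvv : 0 < v * (v - 1) := mul_pos (by linarith) (by linarith)
  have hg : 0 < v * (v - 1) - e := by nlinarith
  set P := ⌊t * (v * (v - 1)) / (v * (v - 1) - e)⌋₊
  have hle : (P : ℝ) ≤ t * (v * (v - 1)) / (v * (v - 1) - e) := Nat.floor_le (by positivity)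
  refine ⟨P, ?_, (le_div_iff₀ hg).1 hle, ?_⟩
  · have htv : 2 * t * (v - 1) ≤ v * (v - 1) - e := by
      have ht' : 2 * t = v - 3 * q := by rw [ht, hv]; ring
      rw [ht']
      nlinarith
    have hhalf : t * (v * (v - 1)) / (v * (v - 1) - e) ≤ v / 2 := by
      rw [div_le_iff₀ hg]
      nlinarith
    linarith
  · have hratio : (v * (v - 1) - e) / (v * (v - 1)) ≤ 1 := (div_le_one hvv).2 (by linarith)
    calc t - 1 ≤ t - (v * (v - 1) - e) / (v * (v - 1)) := by linarith
      _ = (t * (v * (v - 1)) / (v * (v - 1) - e) - 1) * ((v * (v - 1) - e) / (v * (v - 1))) := by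
          rw [sub_mul, div_mul_div_cancel₀ hg.ne', mul_div_cancel_right₀ _ hvv.ne', one_mul]
      _ ≤ P * ((v * (v - 1) - e) / (v * (v - 1))) := by
          gcongr
          exact (Nat.sub_one_lt_floor _).le

lemma sub_four_mul_cube_le {a b μ : ℝ} (hw : 1 ≤ w) (hwn : w ^ 4 = n) (hδ : δ ≤ 1) (ha : 0 ≤ a)
    (hdev : a + w ^ 2 * (b - μ) ^ 2 ≤ δ * n ^ 2 / 4 + 7 * n + 2 * w ^ 6) : μ - 4 * w ^ 3 ≤ b := by
  by_contra! hlt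
  have hfar : (4 * w ^ 3) ^ 2 ≤ (b - μ) ^ 2 := by
    rw [← neg_sub μ, neg_sq]
    have : 4 * w ^ 3 ≤ μ - b := by linarith
    gcongr
  have hbound : 16 * w ^ 8 ≤ δ * n ^ 2 / 4 + 7 * n + 2 * w ^ 6 :=
    calc 16 * w ^ 8 = w ^ 2 * (4 * w ^ 3) ^ 2 := by ring
      _ ≤ w ^ 2 * (b - μ) ^ 2 := by gcongr
      _ ≤ δ * n ^ 2 / 4 + 7 * n + 2 * w ^ 6 := by linarith
  have hδn : δ * n ^ 2 ≤ w ^ 8 := by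
    rw [← hwn]
    nlinarith [pow_pos (zero_lt_one.trans_le hw) 8]
  have hn8 : n ≤ w ^ 8 := hwn ▸ pow_le_pow_right₀ hw (by norm_num)
  have hw6 : w ^ 6 ≤ w ^ 8 := pow_le_pow_right₀ hw (by norm_num)
  have hw8 : 0 < w ^ 8 := by positivity
  linarith

lemma exists_matching_card_ge [Fintype V] (hT : Gᶜ.CliqueFree 3) (hC : G.IsMaximumClique C)
    (h4 : 4 * #C < Fintype.card V) (hn : n = Fintype.card V) (h8 : 8 ≤ n) (hw : 1 ≤ w)
    (hwn : w ^ 4 = n) (hδ : ∀ z ∈ Set.Icc (0 : ℝ) (1 / 4), missingDensity z ≤ δ) (hδ1 : δ ≤ 1) :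
    ∃ M, IsBranchFamily G M ∧ (∀ S ∈ M, S ⊆ Cᶜ ∧ #S = 2) ∧
      2 * (#((touchGraph G)ᶜ.interedges (C.image fun v => {v}) M) : ℝ) +
        #((touchGraph G)ᶜ.interedges M M) ≤ δ * n ^ 2 / 4 + 7 * n + 2 * w ^ 6 ∧
      (n - 4 * #C) / 2 - 1 - 4 * w ^ 3 ≤ #M := by
  have hqn : 4 * (#C : ℝ) ≤ n := by rw [hn]; exact_mod_cast h4.le
  have hv : (#Cᶜ : ℝ) = n - #C := by
    rw [hn, ← card_compl_add_card C, Nat.cast_add, add_sub_cancel_right]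
  have hdeg := degree_compl_le_card hT hC
  have hx : (#(Gᶜ.interedges C Cᶜ) : ℝ) ≤ (#C : ℝ) ^ 2 := by
    rw [pow_two]
    exact_mod_cast card_interedges_le hdeg C Cᶜ
  have he : (#(Gᶜ.interedges Cᶜ Cᶜ) : ℝ) ≤ #C * #Cᶜ - #(Gᶜ.interedges C Cᶜ) := by
    rw [le_sub_iff_add_le]
    exact_mod_cast card_interedges_self_add_le hdeg disjoint_compl_right
  obtain ⟨P, hPv, hPt, hPμ⟩ := exists_number_of_pairs h8 (Nat.cast_nonneg _) hqn hv
    (Nat.cast_nonneg _) (he.trans (sub_le_self _ (Nat.cast_nonneg _))) rfl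
  have h6 : (6 : ℝ) ≤ #Cᶜ := by linarith
  obtain ⟨M, hM, hMC, hcost⟩ := exists_concentrated_matching hdeg disjoint_compl_right
    (by exact_mod_cast h6) (by exact_mod_cast hPv) rfl rfl (sq_nonneg w)
  have hz : #C / n ∈ Set.Icc (0 : ℝ) (1 / 4) :=
    ⟨by positivity, by rw [div_le_div_iff₀ (by linarith) (by norm_num)]; linarith⟩
  have hexpect := expected_cost_le h8 (Nat.cast_nonneg _) hqn hv (Nat.cast_nonneg _) hx
    (Nat.cast_nonneg _) he rfl (Nat.cast_nonneg _) hPv hPt (hδ _ hz) hδ1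
  have hvar : w ^ 2 * (2 * (#Cᶜ : ℝ)) ≤ 2 * w ^ 6 :=
    calc w ^ 2 * (2 * (#Cᶜ : ℝ)) ≤ w ^ 2 * (2 * w ^ 4) := by
          gcongr
          linarith [Nat.cast_nonneg (α := ℝ) #C]
      _ = 2 * w ^ 6 := by ring
  have htotal := hcost.trans (add_le_add hexpect hvar)
  have hdev := sub_four_mul_cube_le hw hwn hδ1 (by positivity) htotal
  refine ⟨M, hM, hMC, le_trans (le_add_of_nonneg_right (by positivity)) htotal, by linarith⟩

lemma exists_matching_of_small_clique [Fintype V] (hT : Gᶜ.CliqueFree 3) (hC : G.IsMaximumClique C)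
    (h4 : 4 * #C < Fintype.card V) (hn : n = Fintype.card V) (h8 : 8 ≤ n) (hw : 1 ≤ w)
    (hwn : w ^ 4 = n) (hδ : ∀ z ∈ Set.Icc (0 : ℝ) (1 / 4), missingDensity z ≤ δ) (hδ1 : δ ≤ 1) :
    ∃ M, IsBranchFamily G M ∧ (∀ S ∈ M, S ⊆ Cᶜ ∧ #S = 2) ∧
      2 * (#((touchGraph G)ᶜ.interedges (C.image fun v => {v}) M) : ℝ) +
        #((touchGraph G)ᶜ.interedges M M) ≤ δ * n ^ 2 / 4 + 7 * n + 2 * w ^ 6 ∧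
      2 * #M + 4 * #C ≤ Fintype.card V ∧ (n - 4 * #C) / 2 - 1 - 4 * w ^ 3 ≤ #M := by
  obtain ⟨M, hM, hMC, hcost, hcard⟩ := exists_matching_card_ge hT hC h4 hn h8 hw hwn hδ hδ1
  obtain ⟨M', hM', hM'c⟩ :=
    exists_subset_card_eq (min_le_left #M ((Fintype.card V - 4 * #C) / 2))
  refine ⟨M', hM.mono hM', fun S hS => hMC S (hM' hS), ?_, by omega, ?_⟩
  · refine le_trans ?_ hcost
    gcongr
    · exact SimpleGraph.interedges_mono _ subset_rfl hM'
    · exact SimpleGraph.interedges_mono _ hM' hM'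
  · have hhalf : Fintype.card V ≤ 2 * ((Fintype.card V - 4 * #C) / 2) + 4 * #C + 1 := by omega
    rw [hM'c, Nat.cast_min, le_min_iff]
    refine ⟨hcard, ?_⟩
    rw [← Nat.cast_le (α := ℝ)] at hhalf
    push_cast [← hn] at hhalf
    have : 0 < w ^ 3 := by positivity
    linarith

lemma exists_gullPacking_of_small_clique [Finite V] (hT : Gᶜ.CliqueFree 3)
    (hC : G.IsMaximumClique C) {L : Finset V} (hL : 3 * #C ≤ #L) :
    ∃ F, IsGullPacking Gᶜ L F ∧ #F ≤ #C ∧ #C ≤ #F + 40 := by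
  have hle : ∀ I : Finset V, Gᶜ.IsIndepSet I → #I ≤ #C := fun I hI =>
    hC.maximum I ((SimpleGraph.isIndepSet_compl _).1 hI)
  refine exists_isGullPacking hT hL (fun I _ hI => ?_) fun X _ Y _ hX hY hXY => ?_
  · have := hle I hI
    omega
  · have hXC := hle X (isIndepSet_of_isCompleteBetween hT hXY hY)
    have hYC := hle Y (isIndepSet_of_isCompleteBetween hT hXY.symm hX)
    omega

lemma exists_minor_of_small_clique [Fintype V] (hT : Gᶜ.CliqueFree 3) (hC : G.IsMaximumClique C)
    (h4 : 4 * #C < Fintype.card V) (hn : n = Fintype.card V) (h8 : 8 ≤ n) (hw : 1 ≤ w)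
    (hwn : w ^ 4 = n) (hδ : ∀ z ∈ Set.Icc (0 : ℝ) (1 / 4), missingDensity z ≤ δ) (hδ1 : δ ≤ 1)
    (hm : 2 * m ≤ Fintype.card V + 1) :
    ∃ H : SimpleGraph (Fin m), H.IsMinor G ∧
      (m * (m - 1) : ℝ) ≤ 2 * H.edgeSet.ncard + (δ * n ^ 2 / 4 + 7 * n + 2 * w ^ 6) +
        2 * (m * (42 + 4 * w ^ 3)) := by
  obtain ⟨M, hM, hMC, hcost, hMle, hMge⟩ :=
    exists_matching_of_small_clique hT hC h4 hn h8 hw hwn hδ hδ1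
  have hcompl := card_compl_add_card C
  have hleft := card_leftover_add_mul_card hM.pairwiseDisjoint (fun S hS => (hMC S hS).1)
    fun S hS => (hMC S hS).2
  obtain ⟨F, hF, hFk, hkF⟩ := exists_gullPacking_of_small_clique hT hC (L := leftover Cᶜ M)
    (by omega)
  obtain ⟨H, hH, hedges⟩ := exists_minor_of_packing hT hC.isClique hM hMC hF (m := m) (by omega)
  refine ⟨H, hH, ?_⟩
  have hunused : ((m - (#C + #M + #F) : ℕ) : ℝ) ≤ 42 + 4 * w ^ 3 := by
    have hm' : 2 * (m : ℝ) ≤ n + 1 := by rw [hn]; exact_mod_cast hm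
    have hF' : (#C : ℝ) ≤ #F + 40 := by exact_mod_cast hkF
    obtain hlt | hle := lt_or_ge m (#C + #M + #F)
    · rw [Nat.sub_eq_zero_of_le hlt.le, Nat.cast_zero]
      positivity
    · push_cast [Nat.cast_sub hle]
      linarith
  have hedges' : (m * (m - 1) : ℝ) ≤ 2 * H.edgeSet.ncard +
      (2 * (#((touchGraph G)ᶜ.interedges (C.image fun v => {v}) M) : ℝ) +
        #((touchGraph G)ᶜ.interedges M M)) + 2 * (m * ((m - (#C + #M + #F) : ℕ) : ℝ)) := by
    rw [← natCast_mul_sub_one]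
    exact_mod_cast hedges
  calc (m * (m - 1) : ℝ) ≤ _ := hedges'
    _ ≤ 2 * H.edgeSet.ncard + (δ * n ^ 2 / 4 + 7 * n + 2 * w ^ 6) +
        2 * (m * (42 + 4 * w ^ 3)) := by gcongr

end SmallClique

section Extremum

lemma missingDensity_denom_pos (z : ℝ) : 0 < 1 - 3 * z + 3 * z ^ 2 := by
  nlinarith [sq_nonneg (2 * z - 1)]

lemma continuous_missingDensity : Continuous missingDensity := by
  unfold missingDensity
  exact Continuous.div (by fun_prop) (by fun_prop) fun z =>
    (pow_pos (missingDensity_denom_pos z) 2).ne'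

lemma missingDensity_le {z : ℝ} (hz : z ∈ Set.Icc (0 : ℝ) (1 / 4)) :
    missingDensity z ≤ 0.013118 := by
  obtain ⟨h0, h1⟩ := hz
  rw [missingDensity, div_le_iff₀ (pow_pos (missingDensity_denom_pos z) 2)]
  -- The maximum is attained near `0.194`; the quartic is the quotient, on division by
  -- `(z - 0.194) ^ 2`, of the polynomial that has to be shown nonnegative.
  have hquotient : 0.3 ≤ 43583264837 / 125000000000 + 187823867 / 125000000 * z +
      5727351 / 500000 * z ^ 2 - 1524 / 25 * z ^ 3 + 80 * z ^ 4 := by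
    have hsq : z ^ 2 ≤ 1 / 4 * z := by nlinarith
    have hcube : z ^ 3 ≤ 1 / 4 * z ^ 2 := by nlinarith [sq_nonneg z]
    have hfourth : 0 ≤ z ^ 4 := by positivity
    linarith
  have hmul := mul_le_mul_of_nonneg_right hquotient (sq_nonneg (z - 0.194))
  nlinarith [sq_nonneg (z - 0.19)]

lemma exists_isGreatest_missingDensity :
    ∃ γ : ℝ, IsGreatest (missingDensity '' Set.Icc (0 : ℝ) (1 / 4)) (1 - γ) ∧
      0.986882 ≤ γ ∧ γ < 0.986883 := by
  obtain ⟨M, hM⟩ := (isCompact_Icc.image continuous_missingDensity).exists_isGreatest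
    ((Set.nonempty_Icc.2 (by norm_num : (0 : ℝ) ≤ 1 / 4)).image missingDensity)
  refine ⟨1 - M, by rwa [sub_sub_cancel], ?_, ?_⟩
  · obtain ⟨z, hz, rfl⟩ := hM.1
    linarith [missingDensity_le hz]
  · have hle : missingDensity 0.194 ≤ M := hM.2 ⟨0.194, by norm_num, rfl⟩
    have hlt : (0.013117 : ℝ) < missingDensity 0.194 := by norm_num [missingDensity]
    linarith

end Extremum

section DenseMinor

variable {V : Type*} {G : SimpleGraph V} {δ w : ℝ} {m : ℕ}

lemma compl_cliqueFree_three_of_indepNum_le_two [Finite V] (h : G.indepNum ≤ 2) :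
    Gᶜ.CliqueFree 3 := by
  rw [SimpleGraph.cliqueFree_compl]
  intro s hs
  have hcard := hs.isIndepSet.card_le_indepNum
  rw [hs.card_eq] at hcard
  omega

lemma exists_isMinor_of_le_card [Fintype V] (G : SimpleGraph V) (hm : m ≤ Fintype.card V) :
    ∃ H : SimpleGraph (Fin m), H.IsMinor G := by
  have hB : IsBranchFamily G ∅ := ⟨by simp, by simp⟩
  obtain ⟨H, hH, -⟩ := hB.exists_isMinor (m := m) (by simpa [leftover] using hm)
  exact ⟨H, hH⟩

lemma small_clique_error_le {n : ℝ} (hw : 1 ≤ w) (hwn : w ^ 4 = n) (hnm : n ≤ 2 * m) (hδ0 : 0 ≤ δ)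
    (hδ1 : δ ≤ 1) :
    δ * n ^ 2 / 4 + 7 * n + 2 * w ^ 6 + 2 * (m * (42 + 4 * w ^ 3)) ≤
      δ * (m * (m - 1)) + 111 * (m * w ^ 3) := by
  have hw3 : (m : ℝ) * 1 ≤ m * w ^ 3 := by
    gcongr
    exact one_le_pow₀ hw
  have hw6 : w ^ 6 ≤ 2 * (m * w ^ 3) :=
    calc w ^ 6 = n * w ^ 2 := by rw [← hwn]; ring
      _ ≤ 2 * m * w ^ 3 := by gcongr; norm_num
      _ = 2 * (m * w ^ 3) := by ring
  have hn0 : 0 ≤ n := by rw [← hwn]; positivity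
  have hδn : δ * n ^ 2 / 4 ≤ δ * (m * (m - 1)) + m :=
    calc δ * n ^ 2 / 4 ≤ δ * (2 * m) ^ 2 / 4 := by gcongr
      _ = δ * (m * (m - 1)) + δ * m := by ring
      _ ≤ δ * (m * (m - 1)) + m := by
          gcongr
          exact mul_le_of_le_one_left (Nat.cast_nonneg _) hδ1
  linarith

lemma exists_minor_card_edges_ge [Fintype V] (hT : Gᶜ.CliqueFree 3)
    (hδ : ∀ z ∈ Set.Icc (0 : ℝ) (1 / 4), missingDensity z ≤ δ) (hδ0 : 0 ≤ δ) (hδ1 : δ ≤ 1)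
    (hwn : w ^ 4 = Fintype.card V) (hw : 1 ≤ w) (h8 : 8 ≤ Fintype.card V)
    (hm : Fintype.card V ≤ 2 * m) (hm' : 2 * m ≤ Fintype.card V + 1) :
    ∃ H : SimpleGraph (Fin m), H.IsMinor G ∧
      (m * (m - 1) : ℝ) ≤ 2 * H.edgeSet.ncard + δ * (m * (m - 1)) + 111 * (m * w ^ 3) := by
  obtain ⟨C, hC⟩ := G.maximumClique_exists
  obtain h4 | h4 := le_or_gt (Fintype.card V) (4 * #C)
  · obtain ⟨H, hH, hedges⟩ := exists_minor_of_large_clique hT hC h4 hm hm'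
    refine ⟨H, hH, ?_⟩
    have hw3 : (m : ℝ) * 1 ≤ m * w ^ 3 := by
      gcongr
      exact one_le_pow₀ hw
    have hδm : 0 ≤ δ * (m * (m - 1)) := mul_nonneg hδ0 (natCast_mul_sub_one_nonneg m)
    rw [← Nat.cast_le (α := ℝ), natCast_mul_sub_one] at hedges
    push_cast at hedges
    linarith
  · obtain ⟨H, hH, hedges⟩ := exists_minor_of_small_clique hT hC h4 rfl
      (by exact_mod_cast h8) hw hwn hδ hδ1 hm'
    have herror := small_clique_error_le hw hwn (by exact_mod_cast hm) hδ0 hδ1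
    exact ⟨H, hH, by linarith⟩

lemma exists_dense_minor [Fintype V] (hT : Gᶜ.CliqueFree 3)
    (hδ : ∀ z ∈ Set.Icc (0 : ℝ) (1 / 4), missingDensity z ≤ δ) (hδ0 : 0 ≤ δ) (hδ1 : δ ≤ 1)
    (hw : 1 ≤ w) (hwn : w ^ 4 = Fintype.card V) (hm : Fintype.card V ≤ 2 * m)
    (hm' : 2 * m ≤ Fintype.card V + 1) :
    ∃ H : SimpleGraph (Fin m), H.IsMinor G ∧
      (1 - δ - 500 / w) * m.choose 2 ≤ H.edgeSet.ncard := by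
  have hw0 : 0 < w := by linarith
  obtain h8 | h8 := lt_or_ge (Fintype.card V) 8
  · have h8' : w ^ 4 < 8 := by rw [hwn]; exact_mod_cast h8
    have hw2 : w < 2 := lt_of_pow_lt_pow_left₀ 4 (by norm_num) (by linarith)
    have hneg : 1 ≤ 500 / w := by rw [le_div_iff₀ hw0]; linarith
    have hcard : 0 < Fintype.card V := by
      rw [← Nat.cast_pos (α := ℝ), ← hwn]
      positivity
    obtain ⟨H, hH⟩ := exists_isMinor_of_le_card G (m := m) (by omega)
    exact ⟨H, hH, (mul_nonpos_of_nonpos_of_nonneg (by linarith) (Nat.cast_nonneg _)).trans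
      (Nat.cast_nonneg _)⟩
  · obtain ⟨H, hH, hedges⟩ := exists_minor_card_edges_ge hT hδ hδ0 hδ1 hwn hw h8 hm hm'
    refine ⟨H, hH, ?_⟩
    have hm4 : w ^ 4 / 4 ≤ m - 1 := by
      rw [hwn]
      have hmR : (Fintype.card V : ℝ) ≤ 2 * m := by exact_mod_cast hm
      have h8R : (8 : ℝ) ≤ Fintype.card V := by exact_mod_cast h8
      linarith
    have herror : 111 * (m * w ^ 3) ≤ 500 / w * (m * (m - 1)) :=
      calc 111 * (m * w ^ 3) ≤ 125 * (m * w ^ 3) := by gcongr; norm_num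
        _ = 500 / w * (m * (w ^ 4 / 4)) := by field_simp; ring
        _ ≤ 500 / w * (m * (m - 1)) := by gcongr
    rw [Nat.cast_choose_two]
    linarith

lemma le_two_mul_ceil_half (n : ℕ) : n ≤ 2 * ⌈(n : ℝ) / 2⌉₊ := by
  rw [← Nat.cast_le (α := ℝ)]
  push_cast
  linarith [Nat.le_ceil ((n : ℝ) / 2)]

lemma two_mul_ceil_half_le (n : ℕ) : 2 * ⌈(n : ℝ) / 2⌉₊ ≤ n + 1 := by
  rw [← Nat.lt_succ_iff, ← Nat.cast_lt (α := ℝ)]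
  push_cast
  linarith [Nat.ceil_lt_add_one (show 0 ≤ (n : ℝ) / 2 by positivity)]

lemma sqrt_sqrt_pow_four {x : ℝ} (hx : 0 ≤ x) : √√x ^ 4 = x := by
  rw [show 4 = 2 * 2 from rfl, pow_mul, Real.sq_sqrt (Real.sqrt_nonneg _), Real.sq_sqrt hx]

end DenseMinor

end

theorem theorem1 :
    ∃ γ : ℝ,
      IsGreatest (missingDensity '' Set.Icc (0 : ℝ) (1 / 4)) (1 - γ) ∧
      0.986882 ≤ γ ∧ γ < 0.986883 ∧
      ∃ ε : ℕ → ℝ, Tendsto ε atTop (𝓝 0) ∧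
        ∀ (V : Type*) [Finite V] (G : SimpleGraph V), G.indepNum ≤ 2 →
          ∃ (m : ℕ) (H : SimpleGraph (Fin m)),
            m = ⌈(Nat.card V : ℝ) / 2⌉₊ ∧
            H.IsMinor G ∧
            (γ - ε (Nat.card V)) * (m.choose 2 : ℝ) ≤ (H.edgeSet.ncard : ℝ) := by
  obtain ⟨γ, hγ, hγ1, hγ2⟩ := exists_isGreatest_missingDensity
  refine ⟨γ, hγ, hγ1, hγ2, fun n => 500 / √√n, ?_, fun V _ G hG => ?_⟩
  · exact (Real.tendsto_sqrt_atTop.comp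
      (Real.tendsto_sqrt_atTop.comp tendsto_natCast_atTop_atTop)).const_div_atTop _
  · cases nonempty_fintype V
    rw [Nat.card_eq_fintype_card]
    have hm := le_two_mul_ceil_half (Fintype.card V)
    have hm' := two_mul_ceil_half_le (Fintype.card V)
    obtain hV | hV := (Fintype.card V).eq_zero_or_pos
    · obtain ⟨H, hH⟩ := exists_isMinor_of_le_card G (m := ⌈(Fintype.card V : ℝ) / 2⌉₊) (by omega)
      exact ⟨_, H, rfl, hH, by simp [hV]⟩
    · obtain ⟨H, hH, hdense⟩ := exists_dense_minor
        (compl_cliqueFree_three_of_indepNum_le_two hG) (fun z hz => hγ.2 ⟨z, hz, rfl⟩)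
        (by linarith) (by linarith)
        (Real.one_le_sqrt.2 (Real.one_le_sqrt.2 (Nat.one_le_cast.2 hV)))
        (sqrt_sqrt_pow_four (Nat.cast_nonneg _)) hm hm'
      exact ⟨_, H, rfl, hH, by rwa [sub_sub_cancel] at hdense⟩
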